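/- **Linearly compact (LC) Hopf algebras.** Let $R$ be a commutative ring, viewed as discrete. An LC-module is an $R$-module $B$ together with a free $R$-module $A$ and a bilinear form $\langle\cdot,\cdot\rangle:A\times B\to R$ such that $b\mapsto\langle\cdot,b\rangle$ is a bijection $B\to\mathrm{Hom}_R(A,R)$; it has the coarsest topology making all maps $\langle a,\cdot\rangle:B\to R$ continuous. A pseudobasis of $B$ is a family $(b_i)$ in $B$ dual to a basis $(a_i)$ of $A$, i.e. $\langle a_i,b_j\rangle=\delta_{ij}$. Put $B\hat\otimes B:=\mathrm{Hom}_R(A\otimes A,R)$, an LC-module via the tautological pairing with $A\otimes A$; here $b\otimes b'$ is the functional $a\otimes a'\mapsto\langle a,b\rangle\langle a',b'\rangle$. Continuous linear maps $\nabla:B\hat\otimes B\to B$, $\iota:R\to B$, $\Delta:B\to B\hat\otimes B$, $\epsilon:B\to R$ make $B$ an LC-Hopf algebra if they are the adjoints of the coproduct, counit, product and unit, respectively, of a Hopf algebra structure on $A$. It is commutative if $\nabla$ is invariant under swapping the two tensor factors. **Labeled posets.** A labeled poset $(P,\gamma)$ is a finite poset $P$ with an injective map $\gamma:P\to\mathbb{Z}$.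 Two labeled posets $(P,\gamma)$, $(Q,\delta)$ are isomorphic if there is a poset isomorphism $\phi:P\to Q$ such that, for every covering relation $s\lessdot t$ in $P$, $\gamma(s)>\gamma(t)$ if and only if $\delta(\phi(s))>\delta(\phi(t))$. The disjoint union $(P,\gamma)\sqcup(Q,\delta)$ is the poset $P\sqcup Q$ labeled by $s\mapsto\gamma(s)-\max_P\gamma$ for $s\in P$ and $s\mapsto\delta(s)-\min_Q\delta+1$ for $s\in Q$. Subsets $S\subseteq P$ carry the induced order and labels. A valley of $(P,\gamma)$ is an element $v$ with $\gamma(x)>\gamma(v)$ for all $x\lessdot v$ and $\gamma(v)<\gamma(y)$ for all $v\lessdot y$. Let $\mathfrak{m}\mathsf{LPoset}$ be the LC-module over $\mathbb{Z}[\beta]$ of all (possibly infinite) $\mathbb{Z}[\beta]$-linear combinations of isomorphism classes $[(P,\gamma)]$ of labeled posets. Let $\mathfrak{m}\mathsf{LPoset}^+$ be defined in the same way from isomorphism classes $[(P,\gamma,V)]$ of labeled posets with a chosen set $V$ of valleys, where isomorphisms are isomorphisms of labeled posets taking $V$ to $V'$. (Each is dual to the free module on the same classes, with the form making the classes orthonormal.)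 **Theorem.** (1) The isomorphism classes $[(P,\gamma)]$ form a pseudobasis of $\mathfrak{m}\mathsf{LPoset}$. There are unique continuous $\mathbb{Z}[\beta]$-linear maps $\nabla:\mathfrak{m}\mathsf{LPoset}\hat\otimes\mathfrak{m}\mathsf{LPoset}\to\mathfrak{m}\mathsf{LPoset}$, $\Delta:\mathfrak{m}\mathsf{LPoset}\to\mathfrak{m}\mathsf{LPoset}\hat\otimes\mathfrak{m}\mathsf{LPoset}$, $\iota:\mathbb{Z}[\beta]\to\mathfrak{m}\mathsf{LPoset}$, $\epsilon:\mathfrak{m}\mathsf{LPoset}\to\mathbb{Z}[\beta]$ such that for all labeled posets $$\nabla([(P,\gamma)]\otimes[(Q,\delta)])=[(P,\gamma)\sqcup(Q,\delta)],\qquad \Delta([(P,\gamma)])=\sum_{(S,T)}\beta^{|S\cap T|}\,[(S,\gamma|_S)]\otimes[(T,\gamma|_T)],$$ $\iota(1)=[\varnothing]$, and $\epsilon([(P,\gamma)])=1$ if $P=\varnothing$ and $0$ otherwise, where $(S,T)$ runs over all ordered pairs of subsets of $P$ with $S$ a lower set, $T$ an upper set, $S\cup T=P$, and $S\cap T$ an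 antichain. With these maps $\mathfrak{m}\mathsf{LPoset}$ is a commutative LC-Hopf algebra. (2) The same holds for $\mathfrak{m}\mathsf{LPoset}^+$: the classes $[(P,\gamma,V)]$ form a pseudobasis; there are unique continuous linear maps with $$\nabla([(P,\gamma,V)]\otimes[(Q,\delta,W)])=[(P\sqcup Q,\gamma\sqcup\delta,V\sqcup W)],\qquad \Delta([(P,\gamma,V)])=\sum_{(S,T)}\beta^{|S\cap T|}\,[(S,\gamma|_S,V\cap S)]\otimes[(T,\gamma|_T,V\cap T)]$$ (the sum over the same pairs), $\iota(1)=[(\varnothing,\varnothing,\varnothing)]$, and $\epsilon([(P,\gamma,V)])=1$ if $P=\varnothing$ and $0$ otherwise; and with these maps $\mathfrak{m}\mathsf{LPoset}^+$ is a commutative LC-Hopf algebra. -/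

import Mathlib

open scoped TensorProduct

universe u v w v' w' x

/-! ### Linearly compact modules -/

/-- An `R`-module `B` presented as a linearly compact module: a free `R`-module `A` with a
bilinear form `A × B → R` that is nondegenerate, in the sense that `b ↦ ⟨·, b⟩` is a bijection
from `B` onto `Hom_R(A, R)`. -/
structure LCForm (R : Type u) (A : Type v) (B : Type w) [CommRing R]
    [AddCommGroup A] [Module R A] [AddCommGroup B] [Module R B] where
  form : A →ₗ[R] B →ₗ[R] R
  free : Module.Free R A
  nondegenerate : Function.Bijective fun b : B => (form.flip b : A →ₗ[R] R)

namespace LCForm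

section General

variable {R : Type u} [CommRing R]
  {A : Type v} {B : Type w} [AddCommGroup A] [Module R A] [AddCommGroup B] [Module R B]
  {A' : Type v'} {B' : Type w'} [AddCommGroup A'] [Module R A'] [AddCommGroup B'] [Module R B']

/-- The linearly compact topology: the coarsest topology on `B` for which all the maps
`⟨a, ·⟩ : B → R` are continuous, where `R` is discrete. -/
@[reducible]
def topology (P : LCForm R A B) : TopologicalSpace B :=
  ⨅ a : A, TopologicalSpace.induced (fun b => P.form a b) ⊥

/-- Continuity of a linear map between linearly compact modules. -/
def IsCont (P : LCForm R A B) (Q : LCForm R A' B') (f : B →ₗ[R] B') : Prop :=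
  @Continuous B B' P.topology Q.topology f

/-- A family `b` in `B` is a pseudobasis if it is dual to a basis of `A`. -/
def IsPseudobasis {I : Type x} (P : LCForm R A B) (b : I → B) : Prop :=
  ∃ a : Module.Basis I R A,
    (∀ i, P.form (a i) (b i) = 1) ∧ ∀ i j, i ≠ j → P.form (a i) (b j) = 0

/-- `ψ : B → B'` is the adjoint of `φ : A' → A`. -/
def IsAdjoint (P : LCForm R A B) (Q : LCForm R A' B') (φ : A' →ₗ[R] A) (ψ : B →ₗ[R] B') : Prop :=
  ∀ a' b, P.form (φ a') b = Q.form a' (ψ b)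

/-- The completed tensor product of `B` and `B'`: the module `Hom_R(A ⊗ A', R)` with its
tautological pairing with `A ⊗ A'`. -/
def tensor (P : LCForm R A B) (Q : LCForm R A' B') :
    LCForm R (A ⊗[R] A') (Module.Dual R (A ⊗[R] A')) where
  form := Module.Dual.eval R (A ⊗[R] A')
  free := by
    have := P.free
    have := Q.free
    infer_instance
  nondegenerate := ⟨fun _ _ h => h, fun f => ⟨f, rfl⟩⟩

/-- The pure tensor `b ⊗ b'` in the completed tensor product: the functional
`a ⊗ a' ↦ ⟨a, b⟩ * ⟨a', b'⟩`. -/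
noncomputable def tmul (P : LCForm R A B) (Q : LCForm R A' B') (b : B) (b' : B') :
    Module.Dual R (A ⊗[R] A') :=
  TensorProduct.dualDistrib R A A' (P.form.flip b ⊗ₜ[R] Q.form.flip b')

end General

/-- The ring `R` itself, dual to `R` under multiplication. -/
def self (R : Type u) [CommRing R] : LCForm R R R where
  form := LinearMap.mul R R
  free := inferInstance
  nondegenerate := by
    refine ⟨fun a b h => ?_, fun f => ⟨f 1, ?_⟩⟩
    · simpa using LinearMap.congr_fun h 1
    · ext
      simp

/-- The completion of the free module with basis `X`: all (possibly infinite) `R`-linear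
combinations of elements of `X`, with the form that makes `X` orthonormal. -/
noncomputable def completion (R : Type u) [CommRing R] (X : Type v) :
    LCForm R (X →₀ R) (X → R) where
  form := (Finsupp.llift R R R X).toLinearMap.flip
  free := inferInstance
  nondegenerate := (Finsupp.llift R R R X).bijective

theorem completion_form_apply (R : Type u) [CommRing R] (X : Type v) (a : X →₀ R) (b : X → R) :
    (completion R X).form a b = a.sum fun i r => r * b i := by
  simp [completion, Finsupp.lift_apply]

end LCForm

/-! ### Linearly compact Hopf algebras -/

section LCHopf

variable {R : Type u} [CommRing R]
  {A : Type v} {B : Type w} [AddCommGroup A] [Module R A] [AddCommGroup B] [Module R B]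

/-- A choice of continuous linear maps `∇ : B ⊗̂ B → B`, `ι : R → B`, `Δ : B → B ⊗̂ B` and
`ε : B → R` on a linearly compact module. -/
@[ext]
structure LCMaps (P : LCForm R A B) where
  mul : Module.Dual R (A ⊗[R] A) →ₗ[R] B
  unit : R →ₗ[R] B
  comul : B →ₗ[R] Module.Dual R (A ⊗[R] A)
  counit : B →ₗ[R] R
  mul_cont : LCForm.IsCont (P.tensor P) P mul
  unit_cont : LCForm.IsCont (LCForm.self R) P unit
  comul_cont : LCForm.IsCont P (P.tensor P) comul
  counit_cont : LCForm.IsCont P (LCForm.self R) counit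

/-- The maps `∇, ι, Δ, ε` make `B` into an LC-Hopf algebra: they are the adjoints of the coproduct,
counit, product and unit of a Hopf algebra structure on the module `A` that `B` is dual to.
A Hopf algebra structure on the `R`-module `A` is given as a Hopf algebra `H` together with an
identification `e : H ≃ A` of `R`-modules. -/
def LCMaps.IsLCHopfAlgebra {P : LCForm R A B} (T : LCMaps P) : Prop :=
  ∃ (H : Type v) (_ : Ring H) (_ : HopfAlgebra R H) (e : H ≃ₗ[R] A),
    LCForm.IsAdjoint (P.tensor P) P
      (TensorProduct.map e.toLinearMap e.toLinearMap ∘ₗ Coalgebra.comul ∘ₗ e.symm.toLinearMap)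
      T.mul ∧
    LCForm.IsAdjoint (LCForm.self R) P (Coalgebra.counit ∘ₗ e.symm.toLinearMap) T.unit ∧
    LCForm.IsAdjoint P (P.tensor P)
      (e.toLinearMap ∘ₗ LinearMap.mul' R H ∘ₗ
        TensorProduct.map e.symm.toLinearMap e.symm.toLinearMap)
      T.comul ∧
    LCForm.IsAdjoint P (LCForm.self R) (e.toLinearMap ∘ₗ Algebra.linearMap R H) T.counit

/-- The product `∇ : B ⊗̂ B → B` is unchanged by swapping the two tensor factors. -/
def LCMaps.IsCommutative {P : LCForm R A B} (T : LCMaps P) : Prop :=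
  T.mul ∘ₗ (TensorProduct.comm R A A).toLinearMap.dualMap = T.mul

end LCHopf

/-! ### Labeled posets -/

/-- A finite poset with an injective integer labeling. -/
structure LabeledPoset where
  carrier : Type
  [order : PartialOrder carrier]
  [finite : Finite carrier]
  label : carrier → ℤ
  label_injective : Function.Injective label

namespace LabeledPoset

attribute [instance] LabeledPoset.order LabeledPoset.finite

/-- The poset isomorphism `φ` identifies the labeling of `P` with one equivalent to that of `Q`:
the labels decrease along the same covering relations. -/
def IsLabelIso (P Q : LabeledPoset) (φ : P.carrier ≃o Q.carrier) : Prop :=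
  ∀ s t : P.carrier, s ⋖ t → (P.label t < P.label s ↔ Q.label (φ t) < Q.label (φ s))

theorem IsLabelIso.symm {P Q : LabeledPoset} {φ : P.carrier ≃o Q.carrier}
    (h : IsLabelIso P Q φ) : IsLabelIso Q P φ.symm := by
  intro s t hst
  have := h (φ.symm s) (φ.symm t) ((apply_covBy_apply_iff φ.symm).2 hst)
  simpa using this.symm

theorem IsLabelIso.trans {P Q U : LabeledPoset} {φ : P.carrier ≃o Q.carrier}
    {ψ : Q.carrier ≃o U.carrier} (h : IsLabelIso P Q φ) (k : IsLabelIso Q U ψ) :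
    IsLabelIso P U (φ.trans ψ) := fun s t hst =>
  (h s t hst).trans (k (φ s) (φ t) ((apply_covBy_apply_iff φ).2 hst))

/-- Isomorphism of labeled posets. -/
instance isoSetoid : Setoid LabeledPoset where
  r P Q := ∃ φ : P.carrier ≃o Q.carrier, IsLabelIso P Q φ
  iseqv :=
    { refl := fun _ => ⟨OrderIso.refl _, fun _ _ _ => Iff.rfl⟩
      symm := fun ⟨φ, h⟩ => ⟨φ.symm, h.symm⟩
      trans := fun ⟨φ, h⟩ ⟨ψ, k⟩ => ⟨φ.trans ψ, h.trans k⟩ }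

/-- The labeling `γ ⊔ δ` of the disjoint union. -/
noncomputable def sumLabel (P Q : LabeledPoset) : P.carrier ⊕ Q.carrier → ℤ
  | Sum.inl s => P.label s - ⨆ i, P.label i
  | Sum.inr s => Q.label s - (⨅ i, Q.label i) + 1

theorem sumLabel_injective (P Q : LabeledPoset) : Function.Injective (sumLabel P Q) := by
  have hP : ∀ s, P.label s ≤ ⨆ i, P.label i :=
    fun s => le_ciSup (Set.finite_range P.label).bddAbove s
  have hQ : ∀ s, (⨅ i, Q.label i) ≤ Q.label s :=
    fun s => ciInf_le (Set.finite_range Q.label).bddBelow s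
  rintro (a | a) (b | b) h <;> simp only [sumLabel] at h
  · exact congrArg _ (P.label_injective (by linarith))
  · linarith [hP a, hQ b]
  · linarith [hP b, hQ a]
  · exact congrArg _ (Q.label_injective (by linarith))

/-- The disjoint union of labeled posets (elements of different summands are incomparable). -/
noncomputable def disjUnion (P Q : LabeledPoset) : LabeledPoset where
  carrier := P.carrier ⊕ Q.carrier
  label := sumLabel P Q
  label_injective := sumLabel_injective P Q

/-- A subset of a labeled poset, with the inherited order and labels. -/
def restrict (P : LabeledPoset) (S : Set P.carrier) : LabeledPoset where
  carrier := S
  label s := P.label s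
  label_injective := P.label_injective.comp Subtype.val_injective

/-- The empty labeled poset. -/
def empty : LabeledPoset where
  carrier := Empty
  label := Empty.elim
  label_injective := fun a => a.elim

/-- The valleys: elements whose label is smaller than that of every element that they cover
and of every element that covers them. -/
def valleys (P : LabeledPoset) : Set P.carrier :=
  {a | (∀ b, b ⋖ a → P.label a < P.label b) ∧ ∀ b, a ⋖ b → P.label a < P.label b}

/-- An ordered pair `(S, T)` of subsets of `P` with `S` a lower set, `T` an upper set,
`S ∪ T = P` and `S ∩ T` an antichain. -/
@[ext]
structure Splitting (P : LabeledPoset) where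
  S : Set P.carrier
  T : Set P.carrier
  isLowerSet : IsLowerSet S
  isUpperSet : IsUpperSet T
  union_eq : S ∪ T = Set.univ
  isAntichain : IsAntichain (· ≤ ·) (S ∩ T)

instance (P : LabeledPoset) : Finite P.Splitting :=
  Finite.of_injective (fun c : P.Splitting => (c.S, c.T)) fun c d h => by
    simp only [Prod.mk.injEq] at h
    exact Splitting.ext h.1 h.2

noncomputable instance (P : LabeledPoset) : Fintype P.Splitting := Fintype.ofFinite _

end LabeledPoset

/-- A labeled poset with a chosen set of valleys. -/
structure MarkedLabeledPoset extends LabeledPoset where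
  marked : Set carrier
  marked_subset : marked ⊆ toLabeledPoset.valleys

namespace MarkedLabeledPoset

open LabeledPoset

/-- Isomorphism of labeled posets with chosen valleys. -/
instance isoSetoid : Setoid MarkedLabeledPoset where
  r P Q := ∃ φ : P.carrier ≃o Q.carrier,
    IsLabelIso P.toLabeledPoset Q.toLabeledPoset φ ∧ φ '' P.marked = Q.marked
  iseqv :=
    { refl := fun _ => ⟨OrderIso.refl _, fun _ _ _ => Iff.rfl, by simp⟩
      symm := fun ⟨φ, h, hV⟩ => ⟨φ.symm, h.symm, by rw [← hV, Set.image_image]; simp⟩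
      trans := fun ⟨φ, h, hV⟩ ⟨ψ, k, kV⟩ =>
        ⟨φ.trans ψ, h.trans k, by rw [← kV, ← hV, Set.image_image]; rfl⟩ }

/-- The disjoint union `(P ⊔ Q, γ ⊔ δ, V ⊔ W)`. -/
noncomputable def disjUnion (P Q : MarkedLabeledPoset) : MarkedLabeledPoset where
  toLabeledPoset := P.toLabeledPoset.disjUnion Q.toLabeledPoset
  marked := Sum.inl '' P.marked ∪ Sum.inr '' Q.marked
  marked_subset := by
    have key1 : ∀ a b : P.carrier, (Sum.inl a : P.carrier ⊕ Q.carrier) ⋖ Sum.inl b → a ⋖ b :=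
      fun a b h => ⟨Sum.inl_lt_inl_iff.1 h.1,
        fun c hac hcb => h.2 (Sum.inl_lt_inl_iff.2 hac) (Sum.inl_lt_inl_iff.2 hcb)⟩
    have key2 : ∀ a b : Q.carrier, (Sum.inr a : P.carrier ⊕ Q.carrier) ⋖ Sum.inr b → a ⋖ b :=
      fun a b h => ⟨Sum.inr_lt_inr_iff.1 h.1,
        fun c hac hcb => h.2 (Sum.inr_lt_inr_iff.2 hac) (Sum.inr_lt_inr_iff.2 hcb)⟩
    rintro _ (⟨a, ha, rfl⟩ | ⟨a, ha, rfl⟩)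
    · have hv := P.marked_subset ha
      refine ⟨?_, ?_⟩
      · rintro (b | b) hb
        · exact sub_lt_sub_right (hv.1 b (key1 b a hb)) _
        · exact absurd hb.lt Sum.not_inr_lt_inl
      · rintro (b | b) hb
        · exact sub_lt_sub_right (hv.2 b (key1 a b hb)) _
        · exact absurd hb.lt Sum.not_inl_lt_inr
    · have hv := Q.marked_subset ha
      refine ⟨?_, ?_⟩
      · rintro (b | b) hb
        · exact absurd hb.lt Sum.not_inl_lt_inr
        · exact add_lt_add_left (sub_lt_sub_right (hv.1 b (key2 b a hb)) _) _
      · rintro (b | b) hb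
        · exact absurd hb.lt Sum.not_inr_lt_inl
        · exact add_lt_add_left (sub_lt_sub_right (hv.2 b (key2 a b hb)) _) _

/-- The restriction `(S, γ, V ∩ S)` to an order-convex subset (such as a lower or upper set);
convexity is what makes the elements of `V ∩ S` valleys of `S`. -/
def restrict (P : MarkedLabeledPoset) (S : Set P.carrier) (hS : S.OrdConnected) :
    MarkedLabeledPoset where
  toLabeledPoset := P.toLabeledPoset.restrict S
  marked := {s : S | (s : P.carrier) ∈ P.marked}
  marked_subset := by
    have key : ∀ a b : S, a ⋖ b → (a : P.carrier) ⋖ b := fun a b h =>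
      ⟨h.1, fun c hac hcb =>
        h.2 (c := ⟨c, hS.out a.2 b.2 ⟨hac.le, hcb.le⟩⟩) hac hcb⟩
    intro a ha
    have hv := P.marked_subset ha
    exact ⟨fun b hb => hv.1 b.1 (key b a hb), fun b hb => hv.2 b.1 (key a b hb)⟩

/-- The empty labeled poset, with no chosen valleys. -/
def empty : MarkedLabeledPoset where
  toLabeledPoset := LabeledPoset.empty
  marked := ∅
  marked_subset := Set.empty_subset _

end MarkedLabeledPoset

/-! ### The linearly compact modules of labeled posets -/

/-- The ring of integer polynomials in one variable `β`. -/
abbrev ZBeta : Type := Polynomial ℤ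

/-- The variable `β`. -/
noncomputable abbrev ZBeta.β : ZBeta := Polynomial.X

/-- Isomorphism classes of labeled posets. -/
abbrev LPosetClass : Type 1 := Quotient LabeledPoset.isoSetoid

/-- Isomorphism classes of labeled posets with chosen valleys. -/
abbrev LPosetPlusClass : Type 1 := Quotient MarkedLabeledPoset.isoSetoid

/-- The module `mLPoset` of all (possibly infinite) `ℤ[β]`-linear combinations of isomorphism
classes of labeled posets. -/
abbrev MLPoset : Type 1 := LPosetClass → ZBeta

/-- The module `mLPoset⁺` of all (possibly infinite) `ℤ[β]`-linear combinations of isomorphism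
classes of labeled posets with chosen valleys. -/
abbrev MLPosetPlus : Type 1 := LPosetPlusClass → ZBeta

/-- The linearly compact structure on `mLPoset`. -/
noncomputable def MLPoset.lc : LCForm ZBeta (LPosetClass →₀ ZBeta) MLPoset :=
  LCForm.completion ZBeta LPosetClass

/-- The linearly compact structure on `mLPoset⁺`. -/
noncomputable def MLPosetPlus.lc : LCForm ZBeta (LPosetPlusClass →₀ ZBeta) MLPosetPlus :=
  LCForm.completion ZBeta LPosetPlusClass

open Classical in
/-- An isomorphism class, as an element of `mLPoset`. -/
noncomputable def MLPoset.ofClass (c : LPosetClass) : MLPoset := Pi.single c 1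

open Classical in
/-- An isomorphism class, as an element of `mLPoset⁺`. -/
noncomputable def MLPosetPlus.ofClass (c : LPosetPlusClass) : MLPosetPlus := Pi.single c 1

/-- The element `[(P, γ)]` of `mLPoset`. -/
noncomputable def MLPoset.cls (P : LabeledPoset) : MLPoset := MLPoset.ofClass (Quotient.mk _ P)

/-- The element `[(P, γ, V)]` of `mLPoset⁺`. -/
noncomputable def MLPosetPlus.cls (P : MarkedLabeledPoset) : MLPosetPlus :=
  MLPosetPlus.ofClass (Quotient.mk _ P)

open Classical in
/-- The formulas for `∇`, `ι`, `Δ`, `ε` on isomorphism classes of labeled posets. -/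
structure MLPoset.IsStructure (M : LCMaps MLPoset.lc) : Prop where
  mul_cls : ∀ P Q : LabeledPoset,
    M.mul (MLPoset.lc.tmul MLPoset.lc (MLPoset.cls P) (MLPoset.cls Q)) =
      MLPoset.cls (P.disjUnion Q)
  unit_one : M.unit 1 = MLPoset.cls LabeledPoset.empty
  comul_cls : ∀ P : LabeledPoset,
    M.comul (MLPoset.cls P) = ∑ c : P.Splitting, ZBeta.β ^ (c.S ∩ c.T).ncard •
      MLPoset.lc.tmul MLPoset.lc (MLPoset.cls (P.restrict c.S)) (MLPoset.cls (P.restrict c.T))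
  counit_cls : ∀ P : LabeledPoset,
    M.counit (MLPoset.cls P) = if IsEmpty P.carrier then 1 else 0

open Classical in
/-- The formulas for `∇`, `ι`, `Δ`, `ε` on isomorphism classes of labeled posets with chosen
valleys. -/
structure MLPosetPlus.IsStructure (M : LCMaps MLPosetPlus.lc) : Prop where
  mul_cls : ∀ P Q : MarkedLabeledPoset,
    M.mul (MLPosetPlus.lc.tmul MLPosetPlus.lc (MLPosetPlus.cls P) (MLPosetPlus.cls Q)) =
      MLPosetPlus.cls (P.disjUnion Q)
  unit_one : M.unit 1 = MLPosetPlus.cls MarkedLabeledPoset.empty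
  comul_cls : ∀ P : MarkedLabeledPoset,
    M.comul (MLPosetPlus.cls P) =
      ∑ c : P.toLabeledPoset.Splitting, ZBeta.β ^ (c.S ∩ c.T).ncard •
        MLPosetPlus.lc.tmul MLPosetPlus.lc
          (MLPosetPlus.cls (P.restrict c.S c.isLowerSet.ordConnected))
          (MLPosetPlus.cls (P.restrict c.T c.isUpperSet.ordConnected))
  counit_cls : ∀ P : MarkedLabeledPoset,
    M.counit (MLPosetPlus.cls P) = if IsEmpty P.carrier then 1 else 0

/-! All the work happens on the predual, the free module on isomorphism classes. It gets a product
dual to `Δ` and a coproduct dual to disjoint union; once these form a Hopf algebra, taking adjoints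
gives the required maps, and adjoints are automatically continuous.

`MonoidCoproduct` isolates what this needs. Classes form a commutative monoid `X` under disjoint
union, the number of elements is additive on it, and only finitely many classes lie below a given
size. A splitting satisfies `|S| + |T| ≥ |P|`, so the product of two finitely supported functions is
finitely supported; a class has finitely many factorizations, so the coproduct lands in the
algebraic tensor product. The Hopf axioms dualize: associativity is coassociativity of the splitting
sum, the bialgebra law is its multiplicativity, and coassociativity and cocommutativity are the
monoid laws of `X`. The powers of `β` leave the product merely filtered by size, but the coproduct
stays graded and connected. Hence `1 - id` is locally nilpotent under convolution, and its geometric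
series is the antipode.

Two combinatorial facts carry the poset side. A splitting of a disjoint union is a pair of
splittings (`splitSum_disjUnion`). Splitting the lower part of a splitting, or its upper part, gives
in either case a triple `(A, B, C)`, and the two exponents of `β` agree by inclusion-exclusion
(`splitSum_lower`, `splitSum_upper`, `overlap_eq`). Restrictions respect isomorphism because all
parts are convex: a covering relation in a convex subset is one in `P`.

The version with chosen valleys is treated directly; the other one is its image under forgetting
valleys. Uniqueness holds because finite combinations of a pseudobasis are dense
(`IsPseudobasis.hom_ext`). -/

/-! ### Coproducts on commutative monoids -/

/-- A coproduct `∑ w (s ⊗ t)` on each element of a commutative monoid `X`, given as the functional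
`f ↦ ∑ w f(s, t)`, that is multiplicative, coassociative and counital, together with an additive
size with finite balls for which the coproduct is subadditive. -/
structure MonoidCoproduct (R : Type u) (X : Type v) [CommRing R] [CommMonoid X] where
  coprod : X → (X → X → R) →ₗ[R] R
  size : X → ℕ
  size_mul : ∀ x y, size (x * y) = size x + size y
  eq_one_of_size : ∀ x, size x = 0 → x = 1
  finite_size_le : ∀ n, {x | size x ≤ n}.Finite
  coprod_eq_zero : ∀ x f, (∀ s t, size x ≤ size s + size t → f s t = 0) → coprod x f = 0
  coassoc : ∀ x (f : X → X → X → R),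
    coprod x (fun s t => coprod s fun a b => f a b t) =
      coprod x fun s t => coprod t fun a b => f s a b
  counit_left : ∀ x (e g : X → R), e 1 = 1 → (∀ s, s ≠ 1 → e s = 0) →
    coprod x (fun s t => e s * g t) = g x
  counit_right : ∀ x (e g : X → R), e 1 = 1 → (∀ s, s ≠ 1 → e s = 0) →
    coprod x (fun s t => g s * e t) = g x
  coprod_one : ∀ f, coprod 1 f = f 1 1
  coprod_mul : ∀ x y f, coprod (x * y) f =
    coprod x fun s t => coprod y fun s' t' => f (s * s') (t * t')

namespace MonoidCoproduct

variable {R : Type u} {X : Type v} [CommRing R] [CommMonoid X] (D : MonoidCoproduct R X)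

theorem size_one : D.size 1 = 0 := by
  have := D.size_mul 1 1
  simp only [mul_one] at this
  omega

/-! ### The graded dual as an algebra -/

/-- The graded dual of the bialgebra with basis `X` and coproduct `D`: its product is dual to the
coproduct `D` and its coproduct is dual to the product of `X`. -/
def GradedDual (_ : MonoidCoproduct R X) : Type _ := X →₀ R

namespace GradedDual

noncomputable instance : AddCommGroup D.GradedDual := inferInstanceAs (AddCommGroup (X →₀ R))
noncomputable instance : Module R D.GradedDual := inferInstanceAs (Module R (X →₀ R))
instance : FunLike D.GradedDual X R := inferInstanceAs (FunLike (X →₀ R) X R)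

variable {D}

/-- The underlying finitely supported function. -/
noncomputable def toFinsupp : D.GradedDual ≃ₗ[R] (X →₀ R) := LinearEquiv.refl R (X →₀ R)

@[ext]
theorem ext {h k : D.GradedDual} (H : ∀ x, h x = k x) : h = k := Finsupp.ext H

@[simp] theorem toFinsupp_apply (h : D.GradedDual) (x : X) : toFinsupp h x = h x := rfl
@[simp] theorem toFinsupp_symm_apply (h : X →₀ R) (x : X) :
    (toFinsupp.symm h : D.GradedDual) x = h x := rfl
@[simp] theorem add_apply (h k : D.GradedDual) (x : X) : (h + k) x = h x + k x := rfl
@[simp] theorem zero_apply (x : X) : (0 : D.GradedDual) x = 0 := rfl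
@[simp] theorem smul_apply (r : R) (h : D.GradedDual) (x : X) : (r • h) x = r * h x := rfl

theorem exists_size_bound (h : D.GradedDual) : ∃ n, ∀ x, n < D.size x → h x = 0 := by
  refine ⟨(toFinsupp h).support.sup D.size, fun x hx => ?_⟩
  by_contra hne
  exact absurd (Finset.le_sup (f := D.size) (Finsupp.mem_support_iff.2 hne)) (not_le.2 hx)

/-- If `h` and `k` vanish above sizes `m` and `n`, subadditivity makes every term of the coproduct
of `x` contribute zero once `x` has size above `m + n`, and only finitely many `x` are left. -/
theorem finite_support_mul (h k : D.GradedDual) :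
    (Function.support fun x => D.coprod x fun s t => h s * k t).Finite := by
  obtain ⟨m, hm⟩ := h.exists_size_bound
  obtain ⟨n, hn⟩ := k.exists_size_bound
  refine (D.finite_size_le (m + n)).subset fun x hx => ?_
  by_contra hlt
  refine hx (D.coprod_eq_zero x _ fun s t hst => ?_)
  simp only [Set.mem_ofPred_eq, not_le] at hlt
  rcases lt_or_ge m (D.size s) with h1 | h1
  · rw [hm s h1, zero_mul]
  · rw [hn t (by omega), mul_zero]

noncomputable instance : Mul D.GradedDual where
  mul h k := toFinsupp.symm (Finsupp.ofSupportFinite _ (finite_support_mul h k))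

noncomputable instance : One D.GradedDual where
  one := toFinsupp.symm (Finsupp.single 1 1)

theorem mul_apply (h k : D.GradedDual) (x : X) :
    (h * k) x = D.coprod x fun s t => h s * k t := rfl

@[simp] theorem one_apply_one : (1 : D.GradedDual) 1 = 1 :=
  Finsupp.single_eq_same

theorem one_apply_of_ne {x : X} (hx : x ≠ 1) : (1 : D.GradedDual) x = 0 :=
  Finsupp.single_eq_of_ne hx

theorem coprod_mul_right (x : X) (f : X → X → R) (r : R) :
    D.coprod x (fun s t => f s t * r) = D.coprod x f * r := by
  rw [mul_comm, ← smul_eq_mul, ← map_smul]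
  congr 1
  ext s t
  simp [mul_comm]

theorem coprod_mul_left (x : X) (f : X → X → R) (r : R) :
    D.coprod x (fun s t => r * f s t) = r * D.coprod x f := by
  rw [← smul_eq_mul, ← map_smul]
  rfl

theorem coprod_add (x : X) (f g : X → X → R) :
    D.coprod x (fun s t => f s t + g s t) = D.coprod x f + D.coprod x g :=
  map_add (D.coprod x) f g

theorem coprod_zero (x : X) : D.coprod x (fun _ _ => 0) = 0 :=
  map_zero (D.coprod x)

noncomputable instance : Ring D.GradedDual where
  __ := (inferInstance : AddCommGroup D.GradedDual)
  left_distrib a b c := by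
    ext x
    simp only [mul_apply, add_apply, mul_add, coprod_add]
  right_distrib a b c := by
    ext x
    simp only [mul_apply, add_apply, add_mul, coprod_add]
  zero_mul a := by
    ext x
    simp only [mul_apply, zero_apply, zero_mul, coprod_zero]
  mul_zero a := by
    ext x
    simp only [mul_apply, zero_apply, mul_zero, coprod_zero]
  mul_assoc a b c := by
    ext x
    simp only [mul_apply, ← coprod_mul_left, ← coprod_mul_right]
    rw [D.coassoc x fun s t u => a s * b t * c u]
    simp only [mul_assoc]
  one_mul a := by
    ext x
    exact D.counit_left x _ _ one_apply_one fun s hs => one_apply_of_ne hs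
  mul_one a := by
    ext x
    exact D.counit_right x _ _ one_apply_one fun s hs => one_apply_of_ne hs

noncomputable instance : Algebra R D.GradedDual :=
  Algebra.ofModule
    (fun r a b => by
      ext x
      simp only [mul_apply, smul_apply, mul_assoc, coprod_mul_left])
    (fun r a b => by
      ext x
      simp only [mul_apply, smul_apply, mul_left_comm, coprod_mul_left])

/-! ### Coordinates on tensor powers; the bialgebra structure -/

/-- The pairing with an element of `X`. -/
noncomputable def eval (x : X) : D.GradedDual →ₗ[R] R where
  toFun h := h x
  map_add' _ _ := rfl
  map_smul' _ _ := rfl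

@[simp] theorem eval_apply (x : X) (h : D.GradedDual) : eval x h = h x := rfl

/-- The coefficient of `x` in the first tensor factor. -/
noncomputable def coord {N : Type w} [AddCommGroup N] [Module R N] (x : X) :
    D.GradedDual ⊗[R] N →ₗ[R] N :=
  TensorProduct.lift ((LinearMap.lsmul R N).comp (eval x))

@[simp] theorem coord_tmul {N : Type w} [AddCommGroup N] [Module R N] (x : X) (h : D.GradedDual)
    (n : N) : coord x (h ⊗ₜ[R] n) = h x • n := rfl

/-- The first factor is free on `X`, so the tensor product consists of finitely supported functions
from `X` to `N`, and `coord x` is evaluation at `x`. -/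
theorem ext_coord {N : Type w} [AddCommGroup N] [Module R N] {t t' : D.GradedDual ⊗[R] N}
    (H : ∀ x, coord x t = coord x t') : t = t' := by
  classical
  have key : ∀ (x : X) (t : D.GradedDual ⊗[R] N),
      TensorProduct.finsuppScalarLeft R N X
        (TensorProduct.congr toFinsupp (LinearEquiv.refl R N) t) x = coord x t := by
    intro x t
    induction t with
    | zero => simp
    | add a b ha hb => simp only [map_add, Finsupp.add_apply, ha, hb]
    | tmul h n => simp
  apply (TensorProduct.congr (toFinsupp (D := D)) (LinearEquiv.refl R N)).injective
  apply (TensorProduct.finsuppScalarLeft R N X).injective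
  ext1 x
  rw [key, key, H]

theorem finite_fiber (D : MonoidCoproduct R X) (z : X) :
    {p : X × X | p.1 * p.2 = z}.Finite := by
  refine ((D.finite_size_le (D.size z)).prod (D.finite_size_le (D.size z))).subset ?_
  rintro ⟨a, b⟩ rfl
  simp [D.size_mul]

/-- The pairs of elements of `X` with a given product. -/
noncomputable def fiber (D : MonoidCoproduct R X) (z : X) : Finset (X × X) :=
  (finite_fiber D z).toFinset

@[simp] theorem mem_fiber {z : X} {p : X × X} : p ∈ fiber D z ↔ p.1 * p.2 = z := by
  simp [fiber]

/-- The basis element dual to an element of `X`. -/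
noncomputable def basisElem (x : X) : D.GradedDual := toFinsupp.symm (Finsupp.single x 1)

open Classical in
theorem basisElem_apply (x y : X) : (basisElem x : D.GradedDual) y = if x = y then 1 else 0 :=
  Finsupp.single_apply

theorem hom_ext {N : Type w} [AddCommGroup N] [Module R N] {f g : D.GradedDual →ₗ[R] N}
    (H : ∀ x, f (basisElem x) = g (basisElem x)) : f = g := by
  have : f ∘ₗ toFinsupp.symm.toLinearMap = g ∘ₗ toFinsupp.symm.toLinearMap := by
    ext x
    exact H x
  ext h
  exact LinearMap.congr_fun this (toFinsupp h)

/-- The coproduct dual to the product of `X`. -/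
noncomputable def comul : D.GradedDual →ₗ[R] D.GradedDual ⊗[R] D.GradedDual :=
  Finsupp.lift _ R X (fun z => ∑ p ∈ fiber D z, basisElem p.1 ⊗ₜ[R] basisElem p.2) ∘ₗ
    toFinsupp.toLinearMap

theorem comul_basisElem (z : X) :
    comul (basisElem z : D.GradedDual) =
      ∑ p ∈ fiber D z, basisElem p.1 ⊗ₜ[R] basisElem p.2 := by
  simp [comul, basisElem]

/-- The pairing of `GradedDual ⊗ GradedDual` with pairs of elements of `X`. -/
noncomputable def eval₂ (x y : X) : D.GradedDual ⊗[R] D.GradedDual →ₗ[R] R :=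
  eval y ∘ₗ coord x

@[simp] theorem eval₂_tmul (x y : X) (h k : D.GradedDual) : eval₂ x y (h ⊗ₜ[R] k) = h x * k y :=
  rfl

/-- The working description of `comul`: with it, each coalgebra identity becomes an identity in `X`
after evaluation. -/
theorem eval₂_comul (x y : X) (h : D.GradedDual) : eval₂ x y (comul h) = h (x * y) := by
  classical
  suffices H : eval₂ x y ∘ₗ comul = eval (D := D) (x * y) from LinearMap.congr_fun H h
  refine hom_ext fun z => ?_
  rw [LinearMap.comp_apply, comul_basisElem, map_sum]
  simp only [eval₂_tmul, basisElem_apply, eval_apply]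
  rw [Finset.sum_congr rfl (g := fun p => if p = (x, y) then 1 else 0)]
  · rw [Finset.sum_ite_eq']
    simp [eq_comm]
  · rintro ⟨a, b⟩ -
    by_cases ha : a = x <;> by_cases hb : b = y <;> simp [ha, hb]

theorem ext_eval₂ {t t' : D.GradedDual ⊗[R] D.GradedDual}
    (H : ∀ x y, eval₂ x y t = eval₂ x y t') : t = t' :=
  ext_coord fun x => ext fun y => H x y

theorem ext_eval₃ {t t' : D.GradedDual ⊗[R] (D.GradedDual ⊗[R] D.GradedDual)}
    (H : ∀ x y z, eval₂ y z (coord x t) = eval₂ y z (coord x t')) : t = t' :=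
  ext_coord fun x => ext_eval₂ (H x)

/-- The counit of the graded dual. -/
noncomputable def counit : D.GradedDual →ₗ[R] R := eval 1

@[simp] theorem counit_apply (h : D.GradedDual) : counit h = h 1 := rfl

noncomputable instance : CoalgebraStruct R D.GradedDual where
  comul := comul
  counit := counit

theorem comul_def : (Coalgebra.comul : D.GradedDual →ₗ[R] _) = comul := rfl
theorem counit_def : (Coalgebra.counit : D.GradedDual →ₗ[R] _) = counit := rfl

/-- With `eval₂_coord_lTensor`, this reduces coassociativity to `(x * y) * z = x * (y * z)`. -/
theorem eval₂_coord_assoc_rTensor (x y z : X) (t : D.GradedDual ⊗[R] D.GradedDual) :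
    eval₂ y z (coord x (TensorProduct.assoc R _ _ _ (comul.rTensor D.GradedDual t))) =
      eval₂ (x * y) z t := by
  induction t with
  | zero => simp
  | add a b ha hb => simp only [map_add, ha, hb]
  | tmul h k =>
    rw [LinearMap.rTensor_tmul, eval₂_tmul, ← eval₂_comul x y h]
    induction comul h with
    | zero => simp
    | add a b ha hb => simp only [map_add, ha, hb, TensorProduct.add_tmul, add_mul]
    | tmul a b => simp [mul_assoc]

theorem eval₂_coord_lTensor (x y z : X) (t : D.GradedDual ⊗[R] D.GradedDual) :
    eval₂ y z (coord x (comul.lTensor D.GradedDual t)) = eval₂ x (y * z) t := by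
  induction t with
  | zero => simp
  | add a b ha hb => simp only [map_add, ha, hb]
  | tmul h k => simp [eval₂_comul]

noncomputable instance : Coalgebra R D.GradedDual where
  coassoc := by
    ext h
    refine ext_eval₃ fun x y z => ?_
    simp only [LinearMap.comp_apply, LinearEquiv.coe_coe, comul_def, eval₂_coord_assoc_rTensor,
      eval₂_coord_lTensor, eval₂_comul, mul_assoc]
  rTensor_counit_comp_comul := by
    rw [comul_def, counit_def]
    ext h
    apply (TensorProduct.lid R D.GradedDual).injective
    ext x
    have : ∀ t : D.GradedDual ⊗[R] D.GradedDual,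
        TensorProduct.lid R _ (counit.rTensor D.GradedDual t) x = eval₂ 1 x t := by
      intro t
      induction t with
      | zero => simp
      | add a b ha hb => simp only [map_add, add_apply, ha, hb]
      | tmul h k => simp
    simp only [LinearMap.comp_apply, this, eval₂_comul]
    simp
  lTensor_counit_comp_comul := by
    rw [comul_def, counit_def]
    ext h
    apply (TensorProduct.rid R D.GradedDual).injective
    ext x
    have : ∀ t : D.GradedDual ⊗[R] D.GradedDual,
        TensorProduct.rid R _ (counit.lTensor D.GradedDual t) x = eval₂ x 1 t := by
      intro t
      induction t with
      | zero => simp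
      | add a b ha hb => simp only [map_add, add_apply, ha, hb]
      | tmul h k => simp [mul_comm]
    simp only [LinearMap.comp_apply, this, eval₂_comul]
    simp

/-- Puts the product of the tensor square in the same shape as the right side of `coprod_mul`, so
that `comul_mul` becomes the dual of that axiom. -/
theorem eval₂_mul (x y : X) (t t' : D.GradedDual ⊗[R] D.GradedDual) :
    eval₂ x y (t * t') =
      D.coprod x fun a b => D.coprod y fun a' b' => eval₂ a a' t * eval₂ b b' t' := by
  induction t with
  | zero => simp [coprod_zero]
  | add t₁ t₂ h₁ h₂ => simp only [add_mul, map_add, h₁, h₂, coprod_add]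
  | tmul h k =>
    induction t' with
    | zero => simp [coprod_zero]
    | add t₁ t₂ h₁ h₂ => simp only [mul_add, map_add, h₁, h₂, coprod_add]
    | tmul h' k' =>
      rw [Algebra.TensorProduct.tmul_mul_tmul]
      rw [eval₂_tmul, mul_apply, ← coprod_mul_right]
      simp only [mul_apply, ← coprod_mul_left, eval₂_tmul, mul_mul_mul_comm]

theorem mul_apply_one (h k : D.GradedDual) : (h * k) 1 = h 1 * k 1 := D.coprod_one _

theorem comul_mul (h k : D.GradedDual) : comul (h * k) = comul h * comul k := by
  refine ext_eval₂ fun x y => ?_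
  simp only [eval₂_mul, eval₂_comul, mul_apply, D.coprod_mul]

/-- Sizes are additive natural numbers and only `1` has size zero. This is what makes the unit
grouplike in `comul_one`. -/
theorem eq_one_of_mul_eq_one (D : MonoidCoproduct R X) {x y : X} (h : x * y = 1) :
    x = 1 ∧ y = 1 := by
  have := D.size_mul x y
  rw [h, D.size_one] at this
  exact ⟨D.eq_one_of_size x (by omega), D.eq_one_of_size y (by omega)⟩

theorem comul_one : comul (1 : D.GradedDual) = 1 := by
  refine ext_eval₂ fun x y => ?_
  rw [eval₂_comul, Algebra.TensorProduct.one_def, eval₂_tmul]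
  by_cases h : x = 1 ∧ y = 1
  · simp [h.1, h.2]
  · rw [one_apply_of_ne fun h' => h (eq_one_of_mul_eq_one D h')]
    by_cases hx : x = 1
    · rw [one_apply_of_ne fun hy => h ⟨hx, hy⟩, mul_zero]
    · rw [one_apply_of_ne hx, zero_mul]

noncomputable instance : Bialgebra R D.GradedDual :=
  Bialgebra.mk' R D.GradedDual (one_apply_one (D := D)) (fun {a b} => mul_apply_one a b) comul_one
    (fun {a b} => comul_mul a b)

/-! ### The antipode as a convolution geometric series -/

open WithConv in
/-- The identity minus the convolution unit. -/
noncomputable def augId (D : MonoidCoproduct R X) :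
    WithConv (D.GradedDual →ₗ[R] D.GradedDual) :=
  1 - toConv LinearMap.id

theorem convMul_basisElem (f g : WithConv (D.GradedDual →ₗ[R] D.GradedDual)) (z : X) :
    (f * g) (basisElem z) = ∑ p ∈ fiber D z, f (basisElem p.1) * g (basisElem p.2) := by
  rw [LinearMap.convMul_apply, comul_def, comul_basisElem]
  simp

theorem augId_basisElem_one : augId D (basisElem 1) = 0 := by
  have : algebraMap R D.GradedDual 1 = basisElem 1 := by
    rw [map_one]
    rfl
  have h1 : (basisElem 1 : D.GradedDual) 1 = 1 := Finsupp.single_eq_same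
  change algebraMap R D.GradedDual ((basisElem 1 : D.GradedDual) 1) - basisElem 1 = 0
  rw [h1, this, sub_self]

/-- Local nilpotence: `augId` kills the basis element at `1`, so each surviving factor uses up at
least one unit of the size of `z`. Only the grading of the coproduct enters; the product need not be
graded. -/
theorem augId_pow_basisElem (n : ℕ) (z : X) (h : D.size z < n) :
    (augId D ^ n) (basisElem z) = 0 := by
  induction n generalizing z with
  | zero => omega
  | succ n ih =>
    rw [pow_succ, convMul_basisElem]
    refine Finset.sum_eq_zero fun p hp => ?_
    rw [mem_fiber] at hp
    by_cases h2 : D.size p.2 = 0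
    · rw [D.eq_one_of_size _ h2, augId_basisElem_one, mul_zero]
    · have := D.size_mul p.1 p.2
      rw [hp] at this
      rw [ih p.1 (by omega), zero_mul]

theorem sum_augId_pow_basisElem (m n : ℕ) (z : X) (h : D.size z < n) (hm : n ≤ m) :
    (∑ i ∈ Finset.range m, augId D ^ i) (basisElem z) =
      (∑ i ∈ Finset.range n, augId D ^ i) (basisElem z) := by
  induction m, hm using Nat.le_induction with
  | base => rfl
  | succ m hm ih =>
    rw [Finset.sum_range_succ, ← ih]
    change _ + (augId D ^ m) (basisElem z) = _
    rw [augId_pow_basisElem m z (by omega)]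
    exact add_zero _

/-- The antipode: the sum of the convolution powers of `augId`. -/
noncomputable def antipode : D.GradedDual →ₗ[R] D.GradedDual :=
  Finsupp.lift _ R X (fun z => (∑ i ∈ Finset.range (D.size z + 1), augId D ^ i) (basisElem z)) ∘ₗ
    toFinsupp.toLinearMap

/-- The cutoff in `antipode` depends on `z`, but every larger one gives the same value. A single
cutoff therefore serves all factors of a given element, and the finite geometric sum identity
applies. -/
theorem antipode_basisElem (z : X) (n : ℕ) (h : D.size z < n) :
    antipode (basisElem z : D.GradedDual) =
      (∑ i ∈ Finset.range n, augId D ^ i) (basisElem z) := by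
  rw [sum_augId_pow_basisElem n (D.size z + 1) z (by omega) (by omega)]
  simp [antipode, basisElem]

open WithConv in
theorem antipode_convMul_id :
    toConv (antipode (D := D)) * toConv LinearMap.id = 1 := by
  refine ofConv_injective (hom_ext fun z => ?_)
  have h := geom_sum_mul_neg (augId D) (D.size z + 1)
  -- The geometric series of `augId` inverts `1 - augId`, which is the identity map.
  have h' : (1 : WithConv (D.GradedDual →ₗ[R] D.GradedDual)) - augId D = toConv LinearMap.id := by
    simp [augId]
  rw [h'] at h
  have h2 := congrArg (fun f => f.ofConv (basisElem z)) h
  change _ = (1 : WithConv (D.GradedDual →ₗ[R] D.GradedDual)) (basisElem z) -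
    (augId D ^ (D.size z + 1)) (basisElem z) at h2
  rw [augId_pow_basisElem _ z (by omega), sub_zero] at h2
  refine Eq.trans ?_ h2
  refine (convMul_basisElem _ _ z).trans (Eq.trans ?_ (convMul_basisElem _ _ z).symm)
  refine Finset.sum_congr rfl fun p hp => ?_
  rw [mem_fiber] at hp
  have := D.size_mul p.1 p.2
  rw [hp] at this
  congr 1
  exact antipode_basisElem _ _ (by omega)

open WithConv in
theorem id_convMul_antipode :
    toConv LinearMap.id * toConv (antipode (D := D)) = 1 := by
  refine ofConv_injective (hom_ext fun z => ?_)
  have h := mul_neg_geom_sum (augId D) (D.size z + 1)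
  have h' : (1 : WithConv (D.GradedDual →ₗ[R] D.GradedDual)) - augId D = toConv LinearMap.id := by
    simp [augId]
  rw [h'] at h
  have h2 := congrArg (fun f => f.ofConv (basisElem z)) h
  change _ = (1 : WithConv (D.GradedDual →ₗ[R] D.GradedDual)) (basisElem z) -
    (augId D ^ (D.size z + 1)) (basisElem z) at h2
  rw [augId_pow_basisElem _ z (by omega), sub_zero] at h2
  refine Eq.trans ?_ h2
  refine (convMul_basisElem _ _ z).trans (Eq.trans ?_ (convMul_basisElem _ _ z).symm)
  refine Finset.sum_congr rfl fun p hp => ?_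
  rw [mem_fiber] at hp
  have := D.size_mul p.1 p.2
  rw [hp] at this
  congr 1
  exact antipode_basisElem _ _ (by omega)

noncomputable instance : HopfAlgebra R D.GradedDual where
  antipode := antipode
  mul_antipode_rTensor_comul := congrArg WithConv.ofConv (antipode_convMul_id (D := D))
  mul_antipode_lTensor_comul := congrArg WithConv.ofConv (id_convMul_antipode (D := D))

end GradedDual

end MonoidCoproduct

/-! ### Adjoints, continuity and pseudobases -/

namespace LCForm

variable {R : Type u} [CommRing R]
  {A : Type v} {B : Type w} [AddCommGroup A] [Module R A] [AddCommGroup B] [Module R B]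
  {A' : Type v'} {B' : Type w'} [AddCommGroup A'] [Module R A'] [AddCommGroup B'] [Module R B']

theorem ext_form (P : LCForm R A B) {b c : B} (h : ∀ a, P.form a b = P.form a c) : b = c :=
  P.nondegenerate.1 (LinearMap.ext h)

/-- The identification of `B` with the dual of `A`. -/
noncomputable def dualEquiv (P : LCForm R A B) : B ≃ₗ[R] Module.Dual R A :=
  LinearEquiv.ofBijective P.form.flip P.nondegenerate

/-- The adjoint of a linear map. -/
noncomputable def adjoint (P : LCForm R A B) (Q : LCForm R A' B') (φ : A' →ₗ[R] A) :
    B →ₗ[R] B' :=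
  Q.dualEquiv.symm.toLinearMap ∘ₗ φ.dualMap ∘ₗ P.dualEquiv.toLinearMap

theorem isAdjoint_adjoint (P : LCForm R A B) (Q : LCForm R A' B') (φ : A' →ₗ[R] A) :
    IsAdjoint P Q φ (adjoint P Q φ) := fun a' b =>
  (LinearMap.congr_fun (Q.dualEquiv.apply_symm_apply (φ.dualMap (P.dualEquiv b))) a').symm

/-- Composing `ψ` with the coordinate `⟨a', ·⟩` gives the coordinate `⟨φ a', ·⟩`, which is
continuous by definition of the topology. -/
theorem IsAdjoint.isCont {P : LCForm R A B} {Q : LCForm R A' B'} {φ : A' →ₗ[R] A}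
    {ψ : B →ₗ[R] B'} (h : IsAdjoint P Q φ ψ) : IsCont P Q ψ := by
  refine continuous_iInf_rng.2 fun a' => continuous_induced_rng.2 ?_
  refine continuous_iInf_dom (i := φ a') ?_
  have : (fun b' => Q.form a' b') ∘ ψ = fun b => P.form (φ a') b := funext fun b => (h a' b).symm
  rw [this]
  exact continuous_induced_dom

/-- A continuous functional vanishes on the common kernel of finitely many elements of `A`. -/
theorem IsCont.exists_finset {P : LCForm R A B} {Q : LCForm R A' B'} {f : B →ₗ[R] B'}
    (hf : IsCont P Q f) (a' : A') :
    ∃ F : Finset A, ∀ b, (∀ a ∈ F, P.form a b = 0) → Q.form a' (f b) = 0 := by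
  let _ := P.topology
  let _ := Q.topology
  let _ : TopologicalSpace R := ⊥
  have _ : DiscreteTopology R := ⟨rfl⟩
  have hQ : Continuous fun b' => Q.form a' b' := continuous_iInf_dom continuous_induced_dom
  have hc : Continuous fun b => Q.form a' (f b) := hQ.comp hf
  have hn : {b | Q.form a' (f b) = 0} ∈ nhds (0 : B) :=
    (isOpen_discrete ({0} : Set R)).preimage hc |>.mem_nhds (by simp)
  rw [nhds_iInf] at hn
  obtain ⟨F, hF, V, hV, hU⟩ := Filter.mem_iInf.1 hn
  refine ⟨hF.toFinset, fun b hb => ?_⟩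
  suffices b ∈ {b | Q.form a' (f b) = 0} from this
  rw [hU]
  refine Set.mem_iInter.2 fun a => ?_
  -- `V a` is a neighbourhood of zero for the topology induced by `⟨a, ·⟩`, so it contains the
  -- kernel of that functional.
  have h := hV a
  rw [nhds_induced, Filter.mem_comap] at h
  obtain ⟨t, ht, hs⟩ := h
  apply hs
  rw [Set.mem_preimage, hb a (hF.mem_toFinset.2 a.2)]
  simpa using mem_of_mem_nhds ht

/-- Density argument: each coordinate of `f` or `g` depends on finitely many functionals, and a
finite combination `z` of the pseudobasis agrees with `y` on all of them. -/
theorem IsPseudobasis.hom_ext {I : Type x} {P : LCForm R A B} {Q : LCForm R A' B'} {b : I → B}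
    (hb : IsPseudobasis P b) {f g : B →ₗ[R] B'} (hf : IsCont P Q f) (hg : IsCont P Q g)
    (h : ∀ i, f (b i) = g (b i)) : f = g := by
  classical
  obtain ⟨a, h1, h0⟩ := hb
  refine LinearMap.ext fun y => Q.ext_form fun a' => ?_
  obtain ⟨F, hF⟩ := hf.exists_finset a'
  obtain ⟨G, hG⟩ := hg.exists_finset a'
  -- `J` collects the basis vectors occurring in the relevant functionals; `z` is the truncation of
  -- `y` to `J`.
  let J : Finset I := (F ∪ G).biUnion fun c => (a.repr c).support
  let z : B := ∑ j ∈ J, P.form (a j) y • b j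
  have hz : ∀ c ∈ F ∪ G, P.form c (y - z) = 0 := by
    intro c hc
    rw [← a.linearCombination_repr c, Finsupp.linearCombination_apply, Finsupp.sum, map_sum,
      LinearMap.sum_apply]
    refine Finset.sum_eq_zero fun j hj => ?_
    have hjJ : j ∈ J := Finset.mem_biUnion.2 ⟨c, hc, hj⟩
    have : P.form (a j) z = P.form (a j) y := by
      rw [map_sum, Finset.sum_eq_single j]
      · simp [h1]
      · intro i _ hij
        simp [h0 j i hij.symm]
      · exact fun hn => absurd hjJ hn
    simp [this]
  have hfg : f z = g z := by
    simp only [z, map_sum, map_smul, h]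
  have e1 := hF (y - z) fun c hc => hz c (Finset.mem_union_left _ hc)
  have e2 := hG (y - z) fun c hc => hz c (Finset.mem_union_right _ hc)
  rw [map_sub, map_sub, sub_eq_zero] at e1 e2
  rw [e1, e2, hfg]

theorem tmul_apply (P : LCForm R A B) (Q : LCForm R A' B') (b : B) (b' : B') (a : A) (a' : A') :
    tmul P Q b b' (a ⊗ₜ[R] a') = P.form a b * Q.form a' b' := rfl

/-- The tensor product of the two dual bases is dual to the pure tensors. This is why values on pure
tensors determine `∇`. -/
theorem IsPseudobasis.tensor {I : Type x} {J : Type*} {P : LCForm R A B} {Q : LCForm R A' B'}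
    {b : I → B} {b' : J → B'} (hb : IsPseudobasis P b) (hb' : IsPseudobasis Q b') :
    IsPseudobasis (P.tensor Q) fun p : I × J => tmul P Q (b p.1) (b' p.2) := by
  obtain ⟨a, h1, h0⟩ := hb
  obtain ⟨a', h1', h0'⟩ := hb'
  have key : ∀ p q : I × J, (P.tensor Q).form ((a.tensorProduct a') p)
      (tmul P Q (b q.1) (b' q.2)) = P.form (a p.1) (b q.1) * Q.form (a' p.2) (b' q.2) := by
    intro p q
    rw [Module.Basis.tensorProduct_apply']
    rfl
  refine ⟨a.tensorProduct a', fun p => by rw [key, h1, h1', mul_one], fun p q hpq => ?_⟩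
  rw [key]
  by_cases h : p.1 = q.1
  · rw [h0' p.2 q.2 fun h' => hpq (Prod.ext h h'), mul_zero]
  · rw [h0 _ _ h, zero_mul]

section completion

variable {X : Type x} [DecidableEq X]

theorem completion_form_single (a : X →₀ R) (c : X) :
    (completion R X).form a (Pi.single c 1) = a c := by
  rw [completion_form_apply, Finsupp.sum]
  simp [Pi.single_apply]

theorem isPseudobasis_completion :
    IsPseudobasis (completion R X) fun c => Pi.single c 1 := by
  refine ⟨Finsupp.basisSingleOne, fun c => ?_, fun c d h => ?_⟩
  · simp [completion_form_single]
  · simp [completion_form_single, h]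

end completion

end LCForm

/-! ### Structure maps on the completion and their values on basis elements -/

namespace MonoidCoproduct

open GradedDual LCForm

variable {R : Type u} {X : Type v} [CommRing R] [CommMonoid X] (D : MonoidCoproduct R X)

/-- The adjoints of the structure maps of the graded dual. -/
noncomputable def lcMaps : LCMaps (completion R X) where
  mul := adjoint ((completion R X).tensor (completion R X)) (completion R X)
    (TensorProduct.map (toFinsupp (D := D)).toLinearMap toFinsupp.toLinearMap ∘ₗ
      Coalgebra.comul ∘ₗ toFinsupp.symm.toLinearMap)
  unit := adjoint (LCForm.self R) (completion R X)
    (Coalgebra.counit ∘ₗ (toFinsupp (D := D)).symm.toLinearMap)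
  comul := adjoint (completion R X) ((completion R X).tensor (completion R X))
    ((toFinsupp (D := D)).toLinearMap ∘ₗ LinearMap.mul' R D.GradedDual ∘ₗ
      TensorProduct.map toFinsupp.symm.toLinearMap toFinsupp.symm.toLinearMap)
  counit := adjoint (completion R X) (LCForm.self R)
    ((toFinsupp (D := D)).toLinearMap ∘ₗ Algebra.linearMap R D.GradedDual)
  mul_cont := (isAdjoint_adjoint _ _ _).isCont
  unit_cont := (isAdjoint_adjoint _ _ _).isCont
  comul_cont := (isAdjoint_adjoint _ _ _).isCont
  counit_cont := (isAdjoint_adjoint _ _ _).isCont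

theorem lcMaps_isLCHopfAlgebra : D.lcMaps.IsLCHopfAlgebra :=
  ⟨D.GradedDual, inferInstance, inferInstance, toFinsupp, isAdjoint_adjoint _ _ _,
    isAdjoint_adjoint _ _ _, isAdjoint_adjoint _ _ _, isAdjoint_adjoint _ _ _⟩

theorem form_lcMaps_mul (a : X →₀ R) (F : Module.Dual R ((X →₀ R) ⊗[R] (X →₀ R))) :
    (completion R X).form a (D.lcMaps.mul F) =
      F (TensorProduct.map (toFinsupp (D := D)).toLinearMap toFinsupp.toLinearMap
        (GradedDual.comul (toFinsupp.symm a))) :=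
  (isAdjoint_adjoint ((completion R X).tensor (completion R X)) (completion R X)
    (TensorProduct.map (toFinsupp (D := D)).toLinearMap toFinsupp.toLinearMap ∘ₗ
      Coalgebra.comul ∘ₗ toFinsupp.symm.toLinearMap) a F).symm

/-- Cocommutativity is commutativity of `X` seen through `eval₂`; its adjoint is commutativity of
`∇`. -/
theorem comm_comul (h : D.GradedDual) :
    TensorProduct.comm R _ _ (GradedDual.comul h) = GradedDual.comul h := by
  have key : ∀ (x y : X) (t : D.GradedDual ⊗[R] D.GradedDual),
      eval₂ x y (TensorProduct.comm R _ _ t) = eval₂ y x t := by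
    intro x y t
    induction t with
    | zero => simp
    | add a b ha hb => simp only [map_add, ha, hb]
    | tmul a b => simp [mul_comm]
  exact ext_eval₂ fun x y => by rw [key, eval₂_comul, eval₂_comul, mul_comm]

theorem lcMaps_isCommutative : D.lcMaps.IsCommutative := by
  refine LinearMap.ext fun F => (completion R X).ext_form fun a => ?_
  rw [LinearMap.comp_apply, form_lcMaps_mul, form_lcMaps_mul]
  change F (TensorProduct.comm R _ _ _) = _
  rw [← TensorProduct.map_comm, comm_comul]

variable [DecidableEq X]

theorem lcMaps_mul_single (x y : X) :
    D.lcMaps.mul (tmul (completion R X) (completion R X) (Pi.single x 1) (Pi.single y 1)) =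
      Pi.single (x * y) 1 := by
  refine (completion R X).ext_form fun a => ?_
  rw [form_lcMaps_mul, completion_form_single]
  have : tmul (completion R X) (completion R X) (Pi.single x 1) (Pi.single y 1) ∘ₗ
      TensorProduct.map (toFinsupp (D := D)).toLinearMap toFinsupp.toLinearMap = eval₂ x y := by
    refine TensorProduct.ext' fun h k => ?_
    rw [LinearMap.comp_apply, TensorProduct.map_tmul, tmul_apply, completion_form_single,
      completion_form_single]
    rfl
  exact (LinearMap.congr_fun this _).trans (eval₂_comul x y _)

theorem lcMaps_unit_one : D.lcMaps.unit 1 = Pi.single 1 1 := by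
  refine (completion R X).ext_form fun a => ?_
  rw [completion_form_single]
  refine (isAdjoint_adjoint (LCForm.self R) (completion R X)
    (Coalgebra.counit ∘ₗ (toFinsupp (D := D)).symm.toLinearMap) a 1).symm.trans ?_
  exact mul_one _

theorem lcMaps_comul_single_tmul (x : X) (a b : X →₀ R) :
    D.lcMaps.comul (Pi.single x 1) (a ⊗ₜ[R] b) = D.coprod x fun s t => a s * b t := by
  refine (isAdjoint_adjoint (completion R X) ((completion R X).tensor (completion R X))
    ((toFinsupp (D := D)).toLinearMap ∘ₗ LinearMap.mul' R D.GradedDual ∘ₗ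
      TensorProduct.map toFinsupp.symm.toLinearMap toFinsupp.symm.toLinearMap)
      (a ⊗ₜ[R] b) (Pi.single x 1)).symm.trans ?_
  rw [completion_form_single]
  rfl

theorem lcMaps_counit_single (x : X) : D.lcMaps.counit (Pi.single x 1) =
    if x = 1 then 1 else 0 := by
  -- Pairing with `1` in `LCForm.self` recovers the scalar itself.
  have h := (isAdjoint_adjoint (completion R X) (LCForm.self R)
    ((toFinsupp (D := D)).toLinearMap ∘ₗ Algebra.linearMap R D.GradedDual) 1 (Pi.single x 1))
  rw [completion_form_single] at h
  refine (one_mul _).symm.trans (h.symm.trans ?_)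
  change algebraMap R D.GradedDual 1 x = _
  rw [map_one]
  split_ifs with hx
  · rw [hx, one_apply_one]
  · exact one_apply_of_ne hx

/-- Continuous structure maps are determined by their values on a pseudobasis. -/
theorem _root_.LCMaps.ext_of_isPseudobasis {A B : Type*} [AddCommGroup A] [Module R A]
    [AddCommGroup B] [Module R B] {I : Type*} {P : LCForm R A B} {b : I → B}
    (hb : IsPseudobasis P b) {M N : LCMaps P}
    (hmul : ∀ i j, M.mul (tmul P P (b i) (b j)) = N.mul (tmul P P (b i) (b j)))
    (hunit : M.unit 1 = N.unit 1) (hcomul : ∀ i, M.comul (b i) = N.comul (b i))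
    (hcounit : ∀ i, M.counit (b i) = N.counit (b i)) : M = N := by
  refine LCMaps.ext ?_ (LinearMap.ext_ring hunit) ?_ ?_
  · exact (hb.tensor hb).hom_ext M.mul_cont N.mul_cont fun p => hmul p.1 p.2
  · exact hb.hom_ext M.comul_cont N.comul_cont hcomul
  · exact hb.hom_ext M.counit_cont N.counit_cont hcounit

end MonoidCoproduct

/-! ### The commutative monoid of labeled posets -/

namespace LabeledPoset

theorem covBy_of_inl {P Q : LabeledPoset} {a b : P.carrier}
    (h : (Sum.inl a : P.carrier ⊕ Q.carrier) ⋖ Sum.inl b) : a ⋖ b :=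
  ⟨Sum.inl_lt_inl_iff.1 h.1,
    fun _ hac hcb => h.2 (Sum.inl_lt_inl_iff.2 hac) (Sum.inl_lt_inl_iff.2 hcb)⟩

theorem covBy_of_inr {P Q : LabeledPoset} {a b : Q.carrier}
    (h : (Sum.inr a : P.carrier ⊕ Q.carrier) ⋖ Sum.inr b) : a ⋖ b :=
  ⟨Sum.inr_lt_inr_iff.1 h.1,
    fun _ hac hcb => h.2 (Sum.inr_lt_inr_iff.2 hac) (Sum.inr_lt_inr_iff.2 hcb)⟩

/-- `sumLabel` translates the labels of each summand. Elements of different summands are never in a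
covering relation, so the size of the shift does not affect the class. -/
theorem sumLabel_inl_lt_iff (P Q : LabeledPoset) (a b : P.carrier) :
    sumLabel P Q (Sum.inl a) < sumLabel P Q (Sum.inl b) ↔ P.label a < P.label b :=
  sub_lt_sub_iff_right _

theorem sumLabel_inr_lt_iff (P Q : LabeledPoset) (a b : Q.carrier) :
    sumLabel P Q (Sum.inr a) < sumLabel P Q (Sum.inr b) ↔ Q.label a < Q.label b :=
  (add_lt_add_iff_right _).trans (sub_lt_sub_iff_right _)

/-- To check that an isomorphism out of a disjoint union respects labels, it suffices to consider
each summand. -/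
theorem isLabelIso_of_disjUnion {P Q U : LabeledPoset} (φ : P.carrier ⊕ Q.carrier ≃o U.carrier)
    (hl : ∀ a b : P.carrier, a ⋖ b →
      (P.label b < P.label a ↔ U.label (φ (Sum.inl b)) < U.label (φ (Sum.inl a))))
    (hr : ∀ a b : Q.carrier, a ⋖ b →
      (Q.label b < Q.label a ↔ U.label (φ (Sum.inr b)) < U.label (φ (Sum.inr a)))) :
    IsLabelIso (P.disjUnion Q) U φ := by
  rintro (a | a) (b | b) h
  · exact (sumLabel_inl_lt_iff P Q b a).trans (hl a b (covBy_of_inl h))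
  · exact absurd h.lt Sum.not_inl_lt_inr
  · exact absurd h.lt Sum.not_inr_lt_inl
  · exact (sumLabel_inr_lt_iff P Q b a).trans (hr a b (covBy_of_inr h))

theorem isLabelIso_sumCongr {P P' Q Q' : LabeledPoset} {φ : P.carrier ≃o P'.carrier}
    {ψ : Q.carrier ≃o Q'.carrier} (h : IsLabelIso P P' φ) (k : IsLabelIso Q Q' ψ) :
    IsLabelIso (P.disjUnion Q) (P'.disjUnion Q') (φ.sumCongr ψ) :=
  isLabelIso_of_disjUnion _
    (fun a b hab => (h a b hab).trans (sumLabel_inl_lt_iff P' Q' (φ b) (φ a)).symm)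
    (fun a b hab => (k a b hab).trans (sumLabel_inr_lt_iff P' Q' (ψ b) (ψ a)).symm)

theorem isLabelIso_sumComm (P Q : LabeledPoset) :
    IsLabelIso (P.disjUnion Q) (Q.disjUnion P) (OrderIso.sumComm P.carrier Q.carrier) :=
  isLabelIso_of_disjUnion _ (fun a b _ => (sumLabel_inr_lt_iff Q P b a).symm)
    (fun a b _ => (sumLabel_inl_lt_iff Q P b a).symm)

theorem isLabelIso_sumAssoc (P Q U : LabeledPoset) :
    IsLabelIso ((P.disjUnion Q).disjUnion U) (P.disjUnion (Q.disjUnion U))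
      (OrderIso.sumAssoc P.carrier Q.carrier U.carrier) := by
  refine isLabelIso_of_disjUnion (P := P.disjUnion Q) _ ?_ ?_
  · rintro (a | a) (b | b) h
    · exact (sumLabel_inl_lt_iff P Q b a).trans (sumLabel_inl_lt_iff P (Q.disjUnion U) b a).symm
    · exact absurd h.lt Sum.not_inl_lt_inr
    · exact absurd h.lt Sum.not_inr_lt_inl
    · exact (sumLabel_inr_lt_iff P Q b a).trans
        ((sumLabel_inr_lt_iff P (Q.disjUnion U) (Sum.inl b) (Sum.inl a)).trans
          (sumLabel_inl_lt_iff Q U b a)).symm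
  · intro a b _
    exact ((sumLabel_inr_lt_iff P (Q.disjUnion U) (Sum.inr b) (Sum.inr a)).trans
      (sumLabel_inr_lt_iff Q U b a)).symm

/-- Removing an empty summand. -/
def sumEmptyIso (P : LabeledPoset) : P.carrier ⊕ Empty ≃o P.carrier where
  toEquiv := Equiv.sumEmpty _ _
  map_rel_iff' := by
    rintro (a | a) (b | b)
    · exact Sum.inl_le_inl_iff.symm
    · exact b.elim
    · exact a.elim
    · exact a.elim

theorem isLabelIso_sumEmptyIso (P : LabeledPoset) :
    IsLabelIso (P.disjUnion empty) P (sumEmptyIso P) :=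
  isLabelIso_of_disjUnion _ (fun _ _ _ => Iff.rfl) (fun a => a.elim)

noncomputable instance : CommMonoid LPosetClass where
  mul := Quotient.map₂ disjUnion fun _ _ ⟨φ, h⟩ _ _ ⟨ψ, k⟩ =>
    ⟨φ.sumCongr ψ, isLabelIso_sumCongr h k⟩
  one := Quotient.mk _ empty
  mul_assoc := by
    rintro ⟨P⟩ ⟨Q⟩ ⟨U⟩
    exact Quotient.sound ⟨_, isLabelIso_sumAssoc P Q U⟩
  mul_comm := by
    rintro ⟨P⟩ ⟨Q⟩
    exact Quotient.sound ⟨_, isLabelIso_sumComm P Q⟩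
  one_mul := by
    rintro ⟨P⟩
    exact Quotient.sound (Setoid.trans ⟨_, isLabelIso_sumComm empty P⟩
      ⟨_, isLabelIso_sumEmptyIso P⟩)
  mul_one := by
    rintro ⟨P⟩
    exact Quotient.sound ⟨_, isLabelIso_sumEmptyIso P⟩

/-! ### Splittings of a poset and of a disjoint union -/

namespace Splitting

variable {P Q : LabeledPoset}

theorem mem_or_mem (c : P.Splitting) (x : P.carrier) : x ∈ c.S ∨ x ∈ c.T := by
  have : x ∈ c.S ∪ c.T := c.union_eq ▸ Set.mem_univ x
  exact this

/-- If `t < s`, the lower and upper set conditions put both elements in `S ∩ T`, against the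
antichain condition. Together with `ofNotLt`, this replaces the definition of a splitting by one
condition that transports easily. -/
theorem not_lt (c : P.Splitting) {s t : P.carrier} (hs : s ∈ c.S) (ht : t ∈ c.T) : ¬ t < s :=
  fun h => h.ne (c.isAntichain.eq ⟨c.isLowerSet h.le hs, ht⟩ ⟨hs, c.isUpperSet h.le ht⟩ h.le)

/-- A covering pair `(S, T)` is a splitting as soon as no element of `T` lies below an
element of `S`. -/
def ofNotLt (S T : Set P.carrier) (hU : ∀ x, x ∈ S ∨ x ∈ T)
    (h : ∀ s ∈ S, ∀ t ∈ T, ¬ t < s) : P.Splitting where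
  S := S
  T := T
  isLowerSet := by
    intro a b hba ha
    by_contra hb
    exact h a ha b ((hU b).resolve_left hb) (hba.lt_of_ne fun e => hb (e ▸ ha))
  isUpperSet := by
    intro a b hab ha
    by_contra hb
    exact h b ((hU b).resolve_right hb) a ha (hab.lt_of_ne fun e => hb (e ▸ ha))
  union_eq := Set.eq_univ_of_forall hU
  isAntichain := fun a ha b hb hab hle => h b hb.1 a ha.2 (lt_of_le_of_ne hle hab)

theorem ext_mem {c d : P.Splitting} (hS : ∀ x, x ∈ c.S ↔ x ∈ d.S) (hT : ∀ x, x ∈ c.T ↔ x ∈ d.T) :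
    c = d :=
  Splitting.ext (Set.ext hS) (Set.ext hT)

/-- Transport of splittings along an isomorphism. -/
def congr (φ : P.carrier ≃o Q.carrier) : P.Splitting ≃ Q.Splitting where
  toFun c := ofNotLt (φ.symm ⁻¹' c.S) (φ.symm ⁻¹' c.T) (fun x => c.mem_or_mem _)
    fun _ hs _ ht h => c.not_lt hs ht (φ.symm.lt_iff_lt.2 h)
  invFun c := ofNotLt (φ ⁻¹' c.S) (φ ⁻¹' c.T) (fun x => c.mem_or_mem _)
    fun _ hs _ ht h => c.not_lt hs ht (φ.lt_iff_lt.2 h)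
  left_inv c := by
    refine ext_mem (fun x => ?_) fun x => ?_ <;> simp [ofNotLt]
  right_inv c := by
    refine ext_mem (fun x => ?_) fun x => ?_ <;> simp [ofNotLt]

/-- The disjoint union of two subsets. -/
def sumSet (S : Set P.carrier) (T : Set Q.carrier) : Set (P.disjUnion Q).carrier :=
  {z : P.carrier ⊕ Q.carrier | Sum.elim (· ∈ S) (· ∈ T) z}

/-- Splittings of a disjoint union are pairs of splittings. -/
noncomputable def sum : P.Splitting × Q.Splitting ≃ (P.disjUnion Q).Splitting where
  toFun c := ofNotLt (sumSet c.1.S c.2.S) (sumSet c.1.T c.2.T)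
    (by
      rintro (x | x)
      · exact c.1.mem_or_mem x
      · exact c.2.mem_or_mem x)
    (by
      rintro (s | s) hs (t | t) ht h
      · exact c.1.not_lt hs ht (Sum.inl_lt_inl_iff.1 h)
      · exact Sum.not_inr_lt_inl h
      · exact Sum.not_inl_lt_inr h
      · exact c.2.not_lt hs ht (Sum.inr_lt_inr_iff.1 h))
  invFun c := (ofNotLt (Sum.inl ⁻¹' c.S) (Sum.inl ⁻¹' c.T) (fun _ => c.mem_or_mem _)
      fun _ hs _ ht h => c.not_lt hs ht (Sum.inl_lt_inl_iff.2 h),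
    ofNotLt (Sum.inr ⁻¹' c.S) (Sum.inr ⁻¹' c.T) (fun _ => c.mem_or_mem _)
      fun _ hs _ ht h => c.not_lt hs ht (Sum.inr_lt_inr_iff.2 h))
  left_inv c := rfl
  right_inv c := by
    refine ext_mem ?_ ?_ <;> rintro (x | x) <;> exact Iff.rfl

theorem _root_.Set.ncard_setOf_sumElim {α β : Type*} [Finite α] [Finite β] (A : Set α)
    (B : Set β) : {z : α ⊕ β | Sum.elim (· ∈ A) (· ∈ B) z}.ncard = A.ncard + B.ncard := by
  have : {z : α ⊕ β | Sum.elim (· ∈ A) (· ∈ B) z} = Sum.inl '' A ∪ Sum.inr '' B := by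
    ext (x | x) <;> simp
  rw [this, Set.ncard_union_eq _ (Set.toFinite _) (Set.toFinite _),
    Set.ncard_image_of_injective _ Sum.inl_injective,
    Set.ncard_image_of_injective _ Sum.inr_injective]
  rw [Set.disjoint_left]
  rintro _ ⟨x, _, rfl⟩ ⟨y, _, h⟩
  cases h

theorem ncard_sumSet_inter (S T : Set P.carrier) (S' T' : Set Q.carrier) :
    (sumSet S S' ∩ sumSet T T').ncard = (S ∩ T).ncard + (S' ∩ T').ncard := by
  have : sumSet S S' ∩ sumSet T T' = sumSet (S ∩ T) (S' ∩ T') := by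
    ext (x | x) <;> exact Iff.rfl
  rw [this]
  exact Set.ncard_setOf_sumElim _ _

/-- The inclusion of a restriction. -/
def inclusion {S : Set P.carrier} : (P.restrict S).carrier → P.carrier := Subtype.val

theorem inclusion_injective {S : Set P.carrier} :
    Function.Injective (inclusion : (P.restrict S).carrier → P.carrier) :=
  Subtype.val_injective

theorem image_inclusion_union {S : Set P.carrier} (d : (P.restrict S).Splitting) :
    inclusion '' d.S ∪ inclusion '' d.T = S := by
  rw [← Set.image_union, d.union_eq]
  exact Subtype.coe_image_univ _

end Splitting

/-! ### Triple splittings, for coassociativity -/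

/-- A triple of subsets covering `P` in which no element of a later one lies below an element
of an earlier one. -/
@[ext]
structure TripleSplitting (P : LabeledPoset) where
  A : Set P.carrier
  B : Set P.carrier
  C : Set P.carrier
  cover : ∀ x, x ∈ A ∨ x ∈ B ∨ x ∈ C
  not_lt_AB : ∀ a ∈ A, ∀ b ∈ B, ¬ b < a
  not_lt_AC : ∀ a ∈ A, ∀ c ∈ C, ¬ c < a
  not_lt_BC : ∀ b ∈ B, ∀ c ∈ C, ¬ c < b

namespace TripleSplitting

variable {P : LabeledPoset}

instance : Finite P.TripleSplitting :=
  Finite.of_injective (fun c : P.TripleSplitting => (c.A, c.B, c.C)) fun c d h => by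
    simp only [Prod.mk.injEq] at h
    exact TripleSplitting.ext h.1 h.2.1 h.2.2

noncomputable instance : Fintype P.TripleSplitting := Fintype.ofFinite _

theorem ordConnected_A (t : P.TripleSplitting) : t.A.OrdConnected := by
  refine ⟨fun a _ b hb x hx => ?_⟩
  rcases eq_or_lt_of_le hx.2 with rfl | h
  · exact hb
  · exact (t.cover x).resolve_right fun hx' => hx'.elim (fun h' => t.not_lt_AB b hb x h' h)
      fun h' => t.not_lt_AC b hb x h' h

/-- A point strictly between two elements of `B` can lie neither in `A`, being above an element of
`B`, nor in `C`, being below one. -/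
theorem ordConnected_B (t : P.TripleSplitting) : t.B.OrdConnected := by
  refine ⟨fun a ha b hb x hx => ?_⟩
  rcases eq_or_lt_of_le hx.1 with rfl | h
  · exact ha
  rcases eq_or_lt_of_le hx.2 with rfl | h'
  · exact hb
  rcases t.cover x with h'' | h'' | h''
  · exact absurd h (t.not_lt_AB x h'' a ha)
  · exact h''
  · exact absurd h' (t.not_lt_BC b hb x h'')

theorem ordConnected_C (t : P.TripleSplitting) : t.C.OrdConnected := by
  refine ⟨fun a ha b _ x hx => ?_⟩
  rcases eq_or_lt_of_le hx.1 with rfl | h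
  · exact ha
  rcases t.cover x with h' | h' | h'
  · exact absurd h (t.not_lt_AC x h' a ha)
  · exact absurd h (t.not_lt_BC x h' a ha)
  · exact h'

/-- Comparing second components inside `P` avoids equalities between subsets of different
restrictions. -/
theorem sigma_ext_left {x y : Σ c : P.Splitting, (P.restrict c.S).Splitting} (h : x.1 = y.1)
    (hS : (Splitting.inclusion '' x.2.S : Set P.carrier) = Splitting.inclusion '' y.2.S)
    (hT : (Splitting.inclusion '' x.2.T : Set P.carrier) = Splitting.inclusion '' y.2.T) : x = y := by
  obtain ⟨c, d⟩ := x
  obtain ⟨c', d'⟩ := y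
  obtain rfl : c = c' := h
  exact congrArg _ (Splitting.ext (Splitting.inclusion_injective.image_injective hS)
    (Splitting.inclusion_injective.image_injective hT))

theorem sigma_ext_right {x y : Σ c : P.Splitting, (P.restrict c.T).Splitting} (h : x.1 = y.1)
    (hS : (Splitting.inclusion '' x.2.S : Set P.carrier) = Splitting.inclusion '' y.2.S)
    (hT : (Splitting.inclusion '' x.2.T : Set P.carrier) = Splitting.inclusion '' y.2.T) : x = y := by
  obtain ⟨c, d⟩ := x
  obtain ⟨c', d'⟩ := y
  obtain rfl : c = c' := h
  exact congrArg _ (Splitting.ext (Splitting.inclusion_injective.image_injective hS)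
    (Splitting.inclusion_injective.image_injective hT))

/-- Splitting the first part of a splitting yields a triple splitting. -/
def leftEquiv (P : LabeledPoset) :
    (Σ c : P.Splitting, (P.restrict c.S).Splitting) ≃ P.TripleSplitting where
  toFun x :=
    { A := Splitting.inclusion '' x.2.S
      B := Splitting.inclusion '' x.2.T
      C := x.1.T
      cover := fun p => by
        rcases x.1.mem_or_mem p with h | h
        · rcases x.2.mem_or_mem ⟨p, h⟩ with h' | h'
          · exact .inl ⟨_, h', rfl⟩
          · exact .inr (.inl ⟨_, h', rfl⟩)
        · exact .inr (.inr h)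
      not_lt_AB := by
        rintro _ ⟨a, ha, rfl⟩ _ ⟨b, hb, rfl⟩ h
        exact x.2.not_lt ha hb h
      not_lt_AC := by
        rintro _ ⟨a, ha, rfl⟩ c hc h
        exact x.1.not_lt a.2 hc h
      not_lt_BC := by
        rintro _ ⟨a, ha, rfl⟩ c hc h
        exact x.1.not_lt a.2 hc h }
  invFun t := ⟨.ofNotLt (t.A ∪ t.B) t.C (fun x => or_assoc.2 (t.cover x))
      (by
        rintro s (hs | hs) c hc
        · exact t.not_lt_AC s hs c hc
        · exact t.not_lt_BC s hs c hc),
    .ofNotLt {s | s.1 ∈ t.A} {s | s.1 ∈ t.B} (fun x => x.2) fun s hs b hb =>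
      t.not_lt_AB s.1 hs b.1 hb⟩
  left_inv x := by
    refine sigma_ext_left (Splitting.ext ?_ rfl) ?_ ?_
    · exact Splitting.image_inclusion_union x.2
    · ext p
      refine ⟨by rintro ⟨y, hy, rfl⟩; exact hy, ?_⟩
      rintro ⟨y, hy, rfl⟩
      exact ⟨⟨Splitting.inclusion y, .inl ⟨y, hy, rfl⟩⟩, ⟨y, hy, rfl⟩, rfl⟩
    · ext p
      refine ⟨by rintro ⟨y, hy, rfl⟩; exact hy, ?_⟩
      rintro ⟨y, hy, rfl⟩
      exact ⟨⟨Splitting.inclusion y, .inr ⟨y, hy, rfl⟩⟩, ⟨y, hy, rfl⟩, rfl⟩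
  right_inv t := by
    refine TripleSplitting.ext ?_ ?_ rfl
    · ext x
      exact ⟨by rintro ⟨y, hy, rfl⟩; exact hy, fun hx => ⟨⟨x, .inl hx⟩, hx, rfl⟩⟩
    · ext x
      exact ⟨by rintro ⟨y, hy, rfl⟩; exact hy, fun hx => ⟨⟨x, .inr hx⟩, hx, rfl⟩⟩

/-- Splitting the second part of a splitting yields a triple splitting. -/
def rightEquiv (P : LabeledPoset) :
    (Σ c : P.Splitting, (P.restrict c.T).Splitting) ≃ P.TripleSplitting where
  toFun x :=
    { A := x.1.S
      B := Splitting.inclusion '' x.2.S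
      C := Splitting.inclusion '' x.2.T
      cover := fun p => by
        rcases x.1.mem_or_mem p with h | h
        · exact .inl h
        · rcases x.2.mem_or_mem ⟨p, h⟩ with h' | h'
          · exact .inr (.inl ⟨_, h', rfl⟩)
          · exact .inr (.inr ⟨_, h', rfl⟩)
      not_lt_BC := by
        rintro _ ⟨a, ha, rfl⟩ _ ⟨b, hb, rfl⟩ h
        exact x.2.not_lt ha hb h
      not_lt_AC := by
        rintro c hc _ ⟨a, ha, rfl⟩ h
        exact x.1.not_lt hc a.2 h
      not_lt_AB := by
        rintro c hc _ ⟨a, ha, rfl⟩ h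
        exact x.1.not_lt hc a.2 h }
  invFun t := ⟨.ofNotLt t.A (t.B ∪ t.C) t.cover
      (by
        rintro a ha s (hs | hs)
        · exact t.not_lt_AB a ha s hs
        · exact t.not_lt_AC a ha s hs),
    .ofNotLt {s | s.1 ∈ t.B} {s | s.1 ∈ t.C} (fun x => x.2) fun s hs b hb =>
      t.not_lt_BC s.1 hs b.1 hb⟩
  left_inv x := by
    refine sigma_ext_right (Splitting.ext rfl ?_) ?_ ?_
    · exact Splitting.image_inclusion_union x.2
    · ext p
      refine ⟨by rintro ⟨y, hy, rfl⟩; exact hy, ?_⟩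
      rintro ⟨y, hy, rfl⟩
      exact ⟨⟨Splitting.inclusion y, .inl ⟨y, hy, rfl⟩⟩, ⟨y, hy, rfl⟩, rfl⟩
    · ext p
      refine ⟨by rintro ⟨y, hy, rfl⟩; exact hy, ?_⟩
      rintro ⟨y, hy, rfl⟩
      exact ⟨⟨Splitting.inclusion y, .inr ⟨y, hy, rfl⟩⟩, ⟨y, hy, rfl⟩, rfl⟩
  right_inv t := by
    refine TripleSplitting.ext rfl ?_ ?_
    · ext x
      exact ⟨by rintro ⟨y, hy, rfl⟩; exact hy, fun hx => ⟨⟨x, .inl hx⟩, hx, rfl⟩⟩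
    · ext x
      exact ⟨by rintro ⟨y, hy, rfl⟩; exact hy, fun hx => ⟨⟨x, .inr hx⟩, hx, rfl⟩⟩

/-- The total size of the overlaps of a triple splitting. -/
noncomputable def overlap (t : P.TripleSplitting) : ℕ :=
  (t.A ∩ t.B).ncard + ((t.A ∪ t.B) ∩ t.C).ncard

/-- By inclusion-exclusion both sides are `|A ∩ B| + |A ∩ C| + |B ∩ C| - |A ∩ B ∩ C|`, so the
exponent of `β` does not depend on the order of splitting. -/
theorem overlap_eq (t : P.TripleSplitting) :
    t.overlap = (t.B ∩ t.C).ncard + (t.A ∩ (t.B ∪ t.C)).ncard := by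
  have h1 := Set.ncard_union_add_ncard_inter (t.A ∩ t.C) (t.B ∩ t.C)
  have h2 := Set.ncard_union_add_ncard_inter (t.A ∩ t.B) (t.A ∩ t.C)
  rw [← Set.union_inter_distrib_right] at h1
  rw [← Set.inter_union_distrib_left] at h2
  have h3 : t.A ∩ t.C ∩ (t.B ∩ t.C) = t.A ∩ t.B ∩ (t.A ∩ t.C) := by
    ext x
    simp only [Set.mem_inter_iff]
    tauto
  rw [h3] at h1
  unfold overlap
  omega

theorem overlap_leftEquiv (x : Σ c : P.Splitting, (P.restrict c.S).Splitting) :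
    (leftEquiv P x).overlap = (x.2.S ∩ x.2.T).ncard + (x.1.S ∩ x.1.T).ncard := by
  have h1 : (leftEquiv P x).A ∩ (leftEquiv P x).B = Splitting.inclusion '' (x.2.S ∩ x.2.T) :=
    (Set.image_inter Splitting.inclusion_injective).symm
  have h2 : (leftEquiv P x).A ∪ (leftEquiv P x).B = x.1.S:=
    Splitting.image_inclusion_union x.2
  rw [overlap, h1, h2, Set.ncard_image_of_injective _ Splitting.inclusion_injective]
  rfl

theorem overlap_rightEquiv (x : Σ c : P.Splitting, (P.restrict c.T).Splitting) :
    (rightEquiv P x).overlap = (x.2.S ∩ x.2.T).ncard + (x.1.S ∩ x.1.T).ncard := by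
  have h1 : (rightEquiv P x).B ∩ (rightEquiv P x).C = Splitting.inclusion '' (x.2.S ∩ x.2.T) :=
    (Set.image_inter Splitting.inclusion_injective).symm
  have h2 : (rightEquiv P x).B ∪ (rightEquiv P x).C = x.1.T:=
    Splitting.image_inclusion_union x.2
  rw [overlap_eq, h1, h2, Set.ncard_image_of_injective _ Splitting.inclusion_injective]
  rfl

end TripleSplitting

end LabeledPoset

/-! ### The monoid of labeled posets with chosen valleys -/

namespace MarkedLabeledPoset

open LabeledPoset

/-- The class of a labeled poset with chosen valleys. -/
def toClass (P : MarkedLabeledPoset) : LPosetPlusClass := Quotient.mk _ P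

theorem toClass_eq {P Q : MarkedLabeledPoset} (φ : P.carrier ≃o Q.carrier)
    (h : IsLabelIso P.toLabeledPoset Q.toLabeledPoset φ)
    (hV : ∀ s, φ s ∈ Q.marked ↔ s ∈ P.marked) : P.toClass = Q.toClass := by
  refine Quotient.sound ⟨φ, h, ?_⟩
  ext t
  obtain ⟨s, rfl⟩ := φ.surjective t
  rw [hV, φ.injective.mem_set_image]

theorem exists_iso_of_toClass_eq {P Q : MarkedLabeledPoset} (h : P.toClass = Q.toClass) :
    ∃ φ : P.carrier ≃o Q.carrier, IsLabelIso P.toLabeledPoset Q.toLabeledPoset φ ∧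
      ∀ s, φ s ∈ Q.marked ↔ s ∈ P.marked := by
  obtain ⟨φ, h, hV⟩ := Quotient.exact h
  refine ⟨φ, h, fun s => ?_⟩
  rw [← hV, φ.injective.mem_set_image]

theorem inl_mem_marked (P Q : MarkedLabeledPoset) (s : P.carrier) :
    (Sum.inl s : P.carrier ⊕ Q.carrier) ∈ (P.disjUnion Q).marked ↔ s ∈ P.marked := by
  change (Sum.inl s : P.carrier ⊕ Q.carrier) ∈ Sum.inl '' P.marked ∪ Sum.inr '' Q.marked ↔ _
  simp

theorem inr_mem_marked (P Q : MarkedLabeledPoset) (s : Q.carrier) :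
    (Sum.inr s : P.carrier ⊕ Q.carrier) ∈ (P.disjUnion Q).marked ↔ s ∈ Q.marked := by
  change (Sum.inr s : P.carrier ⊕ Q.carrier) ∈ Sum.inl '' P.marked ∪ Sum.inr '' Q.marked ↔ _
  simp

noncomputable instance : CommMonoid LPosetPlusClass where
  mul := Quotient.map₂ disjUnion fun P P' hP Q Q' hQ => by
    obtain ⟨φ, h, hV⟩ := exists_iso_of_toClass_eq (Quotient.sound hP)
    obtain ⟨ψ, k, kV⟩ := exists_iso_of_toClass_eq (Quotient.sound hQ)
    refine Quotient.exact (toClass_eq (P := P.disjUnion Q) (Q := P'.disjUnion Q')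
      (φ.sumCongr ψ) (isLabelIso_sumCongr h k) ?_)
    rintro (s | s)
    · exact (inl_mem_marked P' Q' (φ s)).trans ((hV s).trans (inl_mem_marked P Q s).symm)
    · exact (inr_mem_marked P' Q' (ψ s)).trans ((kV s).trans (inr_mem_marked P Q s).symm)
  one := empty.toClass
  mul_assoc := by
    rintro ⟨P⟩ ⟨Q⟩ ⟨U⟩
    refine toClass_eq (P := (P.disjUnion Q).disjUnion U) (Q := P.disjUnion (Q.disjUnion U))
      _ (isLabelIso_sumAssoc _ _ _) ?_
    rintro ((s | s) | s)
    · exact (inl_mem_marked P (Q.disjUnion U) s).trans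
        ((inl_mem_marked (P.disjUnion Q) U (Sum.inl s)).trans (inl_mem_marked P Q s)).symm
    · exact ((inr_mem_marked P (Q.disjUnion U) (Sum.inl s)).trans (inl_mem_marked Q U s)).trans
        ((inl_mem_marked (P.disjUnion Q) U (Sum.inr s)).trans (inr_mem_marked P Q s)).symm
    · exact ((inr_mem_marked P (Q.disjUnion U) (Sum.inr s)).trans (inr_mem_marked Q U s)).trans
        (inr_mem_marked (P.disjUnion Q) U s).symm
  mul_comm := by
    rintro ⟨P⟩ ⟨Q⟩
    refine toClass_eq (P := P.disjUnion Q) (Q := Q.disjUnion P) _ (isLabelIso_sumComm _ _) ?_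
    rintro (s | s)
    · exact (inr_mem_marked Q P s).trans (inl_mem_marked P Q s).symm
    · exact (inl_mem_marked Q P s).trans (inr_mem_marked P Q s).symm
  one_mul := by
    rintro ⟨P⟩
    refine toClass_eq (P := empty.disjUnion P) (Q := P)
      ((OrderIso.sumComm Empty P.carrier).trans (sumEmptyIso P.toLabeledPoset))
      ((isLabelIso_sumComm _ _).trans (isLabelIso_sumEmptyIso _)) ?_
    rintro (s | s)
    · exact s.elim
    · exact (inr_mem_marked empty P s).symm
  mul_one := by
    rintro ⟨P⟩
    refine toClass_eq (P := P.disjUnion empty) (Q := P) _ (isLabelIso_sumEmptyIso _) ?_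
    rintro (s | s)
    · exact (inl_mem_marked P empty s).symm
    · exact s.elim

theorem toClass_mul (P Q : MarkedLabeledPoset) :
    P.toClass * Q.toClass = (P.disjUnion Q).toClass := rfl

theorem toClass_empty : empty.toClass = 1 := rfl

/-- Corresponding restrictions have the same class. -/
theorem toClass_restrict_eq {P Q : MarkedLabeledPoset} {S : Set P.carrier} {T : Set Q.carrier}
    (hS : S.OrdConnected) (hT : T.OrdConnected) (φ : S ≃o T)
    (h : ∀ s t : S, (s : P.carrier) ⋖ t → (P.label t < P.label s ↔ Q.label (φ t) < Q.label (φ s)))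
    (hV : ∀ s : S, (φ s : Q.carrier) ∈ Q.marked ↔ (s : P.carrier) ∈ P.marked) :
    (P.restrict S hS).toClass = (Q.restrict T hT).toClass :=
  toClass_eq (P := P.restrict S hS) (Q := Q.restrict T hT) φ
    -- Convexity of `S` makes a covering relation in `S` a covering relation in `P`.
    (fun s t hst => h s t ⟨hst.1, fun c hac hcb =>
        hst.2 (c := ⟨c, hS.out s.2 t.2 ⟨hac.le, hcb.le⟩⟩) hac hcb⟩) hV

/-- Identifies the parts of an iterated splitting with the parts of the corresponding triple
splitting of `P`. -/
theorem toClass_restrict_restrict (P : MarkedLabeledPoset) {S : Set P.carrier}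
    (hS : S.OrdConnected) {U : Set (P.restrict S hS).carrier} (hU : U.OrdConnected)
    (h : (Splitting.inclusion '' U).OrdConnected) :
    ((P.restrict S hS).restrict U hU).toClass = (P.restrict _ h).toClass :=
  toClass_restrict_eq hU h
    { toEquiv := Equiv.Set.image _ U Splitting.inclusion_injective
      map_rel_iff' := Iff.rfl }
    (fun _ _ _ => Iff.rfl) (fun _ => Iff.rfl)

theorem toClass_restrict_univ (P : MarkedLabeledPoset) {S : Set P.carrier} (hS : S.OrdConnected)
    (h : S = Set.univ) : (P.restrict S hS).toClass = P.toClass := by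
  subst h
  exact toClass_eq (P := P.restrict Set.univ hS) (Q := P) OrderIso.Set.univ
    (fun _ _ _ => Iff.rfl) (fun _ => Iff.rfl)

theorem toClass_eq_one (P : MarkedLabeledPoset) (h : IsEmpty P.carrier) : P.toClass = 1 :=
  toClass_eq (P := P) (Q := empty)
    { toEquiv := Equiv.equivOfIsEmpty P.carrier Empty, map_rel_iff' := fun {a} => h.elim a }
    (fun s => h.elim s) (fun s => h.elim s)

/-- Restricting before or after the union normalizes labels by different extrema, but label
comparisons within each summand are the same. -/
theorem toClass_restrict_disjUnion (P Q : MarkedLabeledPoset) {S : Set P.carrier}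
    {T : Set Q.carrier} (hS : S.OrdConnected) (hT : T.OrdConnected)
    (h : (Splitting.sumSet S T).OrdConnected) :
    ((P.disjUnion Q).restrict (Splitting.sumSet S T) h).toClass =
      (P.restrict S hS).toClass * (Q.restrict T hT).toClass := by
  let e : S ⊕ T ≃o Splitting.sumSet S T :=
    { toEquiv := (Equiv.subtypeSum (p := fun z => z ∈ Splitting.sumSet S T)).symm
      map_rel_iff' := by
        rintro (a | a) (b | b)
        · exact (Sum.inl_le_inl_iff (a := a.1) (b := b.1)).trans
            (Sum.inl_le_inl_iff (a := a) (b := b)).symm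
        · exact iff_of_false Sum.not_inl_le_inr Sum.not_inl_le_inr
        · exact iff_of_false Sum.not_inr_le_inl Sum.not_inr_le_inl
        · exact (Sum.inr_le_inr_iff (a := a.1) (b := b.1)).trans
            (Sum.inr_le_inr_iff (a := a) (b := b)).symm }
  rw [toClass_mul]
  symm
  refine toClass_eq (P := (P.restrict S hS).disjUnion (Q.restrict T hT))
    (Q := (P.disjUnion Q).restrict (Splitting.sumSet S T) h) e ?_ ?_
  · refine isLabelIso_of_disjUnion (P := (P.restrict S hS).toLabeledPoset)
      (Q := (Q.restrict T hT).toLabeledPoset) _ (fun a b _ => ?_) fun a b _ => ?_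
    · exact (sumLabel_inl_lt_iff P.toLabeledPoset Q.toLabeledPoset b.1 a.1).symm
    · exact (sumLabel_inr_lt_iff P.toLabeledPoset Q.toLabeledPoset b.1 a.1).symm
  · rintro (s | s)
    · exact (inl_mem_marked P Q s.1).trans
        (inl_mem_marked (P.restrict S hS) (Q.restrict T hT) s).symm
    · exact (inr_mem_marked P Q s.1).trans
        (inr_mem_marked (P.restrict S hS) (Q.restrict T hT) s).symm

/-! ### The splitting coproduct on classes -/

/-- The class of the first part of a splitting. -/
def lower (P : MarkedLabeledPoset) (c : P.Splitting) : LPosetPlusClass :=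
  (P.restrict c.S c.isLowerSet.ordConnected).toClass

/-- The class of the second part of a splitting. -/
def upper (P : MarkedLabeledPoset) (c : P.Splitting) : LPosetPlusClass :=
  (P.restrict c.T c.isUpperSet.ordConnected).toClass

/-- The functional given by summation over all splittings. -/
noncomputable def splitSum (P : MarkedLabeledPoset) :
    (LPosetPlusClass → LPosetPlusClass → ZBeta) →ₗ[ZBeta] ZBeta where
  toFun f := ∑ c : P.Splitting, ZBeta.β ^ (c.S ∩ c.T).ncard * f (P.lower c) (P.upper c)
  map_add' f g := by simp [mul_add, Finset.sum_add_distrib]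
  map_smul' r f := by simp [Finset.mul_sum, mul_left_comm]

theorem splitSum_apply (P : MarkedLabeledPoset) (f) : P.splitSum f =
    ∑ c : P.Splitting, ZBeta.β ^ (c.S ∩ c.T).ncard * f (P.lower c) (P.upper c) := rfl

theorem splitSum_congr {P Q : MarkedLabeledPoset} (h : P.toClass = Q.toClass) :
    P.splitSum = Q.splitSum := by
  obtain ⟨φ, h, hV⟩ := exists_iso_of_toClass_eq h
  have key : ∀ (S : Set P.carrier) (hS : S.OrdConnected) (hT : (φ.symm ⁻¹' S).OrdConnected),
      (P.restrict S hS).toClass = (Q.restrict (φ.symm ⁻¹' S) hT).toClass := by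
    intro S hS hT
    refine toClass_restrict_eq hS hT
      { toEquiv := φ.toEquiv.subtypeEquiv fun a => by simp
        map_rel_iff' := φ.map_rel_iff } (fun s t hst => h s t hst) (fun s => hV s)
  ext1 f
  refine Fintype.sum_equiv (Splitting.congr φ) _ _ fun c => ?_
  have h1 : (φ.symm ⁻¹' c.S ∩ φ.symm ⁻¹' c.T).ncard = (c.S ∩ c.T).ncard := by
    rw [← Set.preimage_inter, ← φ.image_eq_preimage_symm,
      Set.ncard_image_of_injective _ φ.injective]
  exact congr_arg₂ _ (congrArg _ h1.symm) (congr_arg₂ f (key _ _ _) (key _ _ _))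

/-- The coproduct on classes. -/
noncomputable def coprod (x : LPosetPlusClass) :
    (LPosetPlusClass → LPosetPlusClass → ZBeta) →ₗ[ZBeta] ZBeta :=
  Quotient.lift splitSum (fun _ _ h => splitSum_congr (Quotient.sound h)) x

theorem coprod_toClass (P : MarkedLabeledPoset) : coprod P.toClass = P.splitSum := rfl

/-- The number of elements. -/
noncomputable def size (x : LPosetPlusClass) : ℕ :=
  Quotient.lift (fun P : MarkedLabeledPoset => Nat.card P.carrier)
    (fun _ _ h => Nat.card_congr (Classical.choose h).toEquiv) x

theorem size_toClass (P : MarkedLabeledPoset) : size P.toClass = Nat.card P.carrier := rfl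

theorem size_restrict (P : MarkedLabeledPoset) {S : Set P.carrier} (hS : S.OrdConnected) :
    size (P.restrict S hS).toClass = S.ncard := rfl

theorem toClass_eq_one_iff (P : MarkedLabeledPoset) : P.toClass = 1 ↔ IsEmpty P.carrier := by
  refine ⟨fun h => ?_, P.toClass_eq_one⟩
  obtain ⟨φ, -⟩ := exists_iso_of_toClass_eq (h.trans toClass_empty.symm)
  exact ⟨fun a => (φ a).elim⟩

theorem restrict_eq_one_iff (P : MarkedLabeledPoset) {S : Set P.carrier} (hS : S.OrdConnected) :
    (P.restrict S hS).toClass = 1 ↔ S = ∅ :=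
  (toClass_eq_one_iff _).trans Set.isEmpty_coe_sort

theorem exists_toClass (x : LPosetPlusClass) : ∃ P : MarkedLabeledPoset, P.toClass = x :=
  Quotient.exists_rep x

/-- Transported to `Fin n`, the order, the comparison of labels and the marked set determine the
class, and they take finitely many values. -/
theorem finite_size_eq (n : ℕ) : {x | size x = n}.Finite := by
  have hex : ∀ x : {x | size x = n}, ∃ (P : MarkedLabeledPoset) (_ : P.carrier ≃ Fin n),
      P.toClass = x.1 := by
    rintro ⟨x, hx⟩
    obtain ⟨P, rfl⟩ := exists_toClass x
    exact ⟨P, Finite.equivFinOfCardEq hx, rfl⟩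
  choose P e hP using hex
  let code : {x | size x = n} → (Fin n → Fin n → Prop) × (Fin n → Fin n → Prop) × (Fin n → Prop) :=
    fun x => (fun i j => (e x).symm i ≤ (e x).symm j,
      fun i j => (P x).label ((e x).symm i) < (P x).label ((e x).symm j),
      fun i => (e x).symm i ∈ (P x).marked)
  refine Set.finite_coe_iff.1 (Finite.of_injective code fun x y hxy => ?_)
  simp only [code, Prod.mk.injEq] at hxy
  obtain ⟨h1, h2, h3⟩ := hxy
  refine Subtype.ext ((hP x).symm.trans (Eq.trans ?_ (hP y)))
  refine toClass_eq { toEquiv := (e x).trans (e y).symm, map_rel_iff' := ?_ } ?_ ?_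
  · intro a b
    have := congr_fun (congr_fun h1 (e x a)) (e x b)
    simpa using this.symm
  · intro a b _
    have := congr_fun (congr_fun h2 (e x b)) (e x a)
    simpa using this
  · intro a
    have := congr_fun h3 (e x a)
    simpa using this.symm

theorem splitSum_disjUnion (P Q : MarkedLabeledPoset) (f) :
    (P.disjUnion Q).splitSum f =
      P.splitSum fun s t => Q.splitSum fun s' t' => f (s * s') (t * t') := by
  simp only [splitSum_apply, Finset.mul_sum]
  rw [← Fintype.sum_prod_type']
  refine (Fintype.sum_equiv Splitting.sum _ _ fun c => ?_).symm
  have h1 : ((Splitting.sum c).S ∩ (Splitting.sum c).T).ncard = _ :=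
    Splitting.ncard_sumSet_inter c.1.S c.1.T c.2.S c.2.T
  have h2 : lower (P.disjUnion Q) (Splitting.sum c) = P.lower c.1 * Q.lower c.2 :=
    toClass_restrict_disjUnion P Q _ _ _
  have h3 : upper (P.disjUnion Q) (Splitting.sum c) = P.upper c.1 * Q.upper c.2 :=
    toClass_restrict_disjUnion P Q _ _ _
  refine Eq.trans ?_ (congr_arg₂ _ (congrArg _ h1.symm) (congr_arg₂ f h2.symm h3.symm))
  rw [pow_add, mul_assoc]

/-- Summation over triple splittings. -/
noncomputable def tripleSum (P : MarkedLabeledPoset)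
    (f : LPosetPlusClass → LPosetPlusClass → LPosetPlusClass → ZBeta) : ZBeta :=
  ∑ t : P.TripleSplitting, ZBeta.β ^ t.overlap *
    f (P.restrict t.A t.ordConnected_A).toClass (P.restrict t.B t.ordConnected_B).toClass
      (P.restrict t.C t.ordConnected_C).toClass

theorem splitSum_lower (P : MarkedLabeledPoset) (f) :
    P.splitSum (fun s t => coprod s fun a b => f a b t) = P.tripleSum f := by
  simp only [splitSum_apply, lower, coprod_toClass, Finset.mul_sum]
  rw [Finset.sum_sigma']
  refine Fintype.sum_equiv (TripleSplitting.leftEquiv P.toLabeledPoset) _ _ fun x => ?_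
  rw [TripleSplitting.overlap_leftEquiv, pow_add, mul_comm (_ ^ _) (_ ^ _), mul_assoc]
  exact congrArg _ (congrArg _ (congr_arg₂ (fun a b => f a b _)
    (toClass_restrict_restrict P _ _ _) (toClass_restrict_restrict P _ _ _)))

theorem splitSum_upper (P : MarkedLabeledPoset) (f) :
    P.splitSum (fun s t => coprod t fun a b => f s a b) = P.tripleSum f := by
  simp only [splitSum_apply, upper, coprod_toClass, Finset.mul_sum]
  rw [Finset.sum_sigma']
  refine Fintype.sum_equiv (TripleSplitting.rightEquiv P.toLabeledPoset) _ _ fun x => ?_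
  rw [TripleSplitting.overlap_rightEquiv, pow_add, mul_comm (_ ^ _) (_ ^ _), mul_assoc]
  exact congrArg _ (congrArg _ (congr_arg₂ (f _)
    (toClass_restrict_restrict P _ _ _) (toClass_restrict_restrict P _ _ _)))

/-- An empty lower part forces the splitting `(∅, P)`, whose overlap is empty, so exactly one term
of the sum survives. -/
theorem splitSum_eq_of_left (P : MarkedLabeledPoset) (f : LPosetPlusClass → LPosetPlusClass → ZBeta)
    (h : ∀ s t, s ≠ 1 → f s t = 0) : P.splitSum f = f 1 P.toClass := by
  rw [splitSum_apply, Finset.sum_eq_single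
    (Splitting.ofNotLt ∅ Set.univ (fun x => .inr trivial) fun _ h => h.elim)]
  · have h1 : P.lower (Splitting.ofNotLt ∅ Set.univ (fun x => .inr trivial) fun _ h => h.elim) = 1 :=
      (restrict_eq_one_iff P _).2 rfl
    have h2 : P.upper (Splitting.ofNotLt ∅ Set.univ (fun x => .inr trivial) fun _ h => h.elim) =
        P.toClass := toClass_restrict_univ P _ rfl
    rw [h1, h2]
    simp [Splitting.ofNotLt]
  · intro c _ hc
    rw [h _ _ fun h1 => hc ?_, mul_zero]
    have hS : c.S = ∅ := (restrict_eq_one_iff P _).1 h1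
    refine Splitting.ext hS ?_
    have := c.union_eq
    rwa [hS, Set.empty_union] at this
  · exact fun h => absurd (Finset.mem_univ _) h

theorem splitSum_eq_of_right (P : MarkedLabeledPoset)
    (f : LPosetPlusClass → LPosetPlusClass → ZBeta)
    (h : ∀ s t, t ≠ 1 → f s t = 0) : P.splitSum f = f P.toClass 1 := by
  rw [splitSum_apply, Finset.sum_eq_single
    (Splitting.ofNotLt Set.univ ∅ (fun x => .inl trivial) fun _ _ _ h => h.elim)]
  · have h1 : P.upper (Splitting.ofNotLt Set.univ ∅ (fun x => .inl trivial)
        fun _ _ _ h => h.elim) = 1 := (restrict_eq_one_iff P _).2 rfl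
    have h2 : P.lower (Splitting.ofNotLt Set.univ ∅ (fun x => .inl trivial)
        fun _ _ _ h => h.elim) = P.toClass := toClass_restrict_univ P _ rfl
    rw [h1, h2]
    simp [Splitting.ofNotLt]
  · intro c _ hc
    rw [h _ _ fun h1 => hc ?_, mul_zero]
    have hT : c.T = ∅ := (restrict_eq_one_iff P _).1 h1
    refine Splitting.ext ?_ hT
    have := c.union_eq
    rwa [hT, Set.union_empty] at this
  · exact fun h => absurd (Finset.mem_univ _) h

/-- The coproduct on isomorphism classes of labeled posets with chosen valleys. -/
noncomputable def monoidCoproduct : MonoidCoproduct ZBeta LPosetPlusClass where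
  coprod := coprod
  size := size
  size_mul x y := by
    obtain ⟨P, rfl⟩ := exists_toClass x
    obtain ⟨Q, rfl⟩ := exists_toClass y
    exact Nat.card_sum
  eq_one_of_size x hx := by
    obtain ⟨P, rfl⟩ := exists_toClass x
    exact P.toClass_eq_one (Finite.card_eq_zero_iff.1 hx)
  finite_size_le n := by
    refine ((Set.finite_Iic n).biUnion fun m _ => finite_size_eq m).subset fun x hx => ?_
    exact Set.mem_biUnion (show size x ∈ Set.Iic n from hx) rfl
  coprod_eq_zero x f h := by
    obtain ⟨P, rfl⟩ := exists_toClass x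
    rw [coprod_toClass, splitSum_apply]
    refine Finset.sum_eq_zero fun c _ => ?_
    rw [h, mul_zero]
    -- Subadditivity is `|S ∪ T| ≤ |S| + |T|` with `S ∪ T` all of `P`.
    rw [lower, upper, size_restrict, size_restrict, size_toClass, ← Set.ncard_univ, ← c.union_eq]
    exact Set.ncard_union_le _ _
  coassoc x f := by
    obtain ⟨P, rfl⟩ := exists_toClass x
    exact (P.splitSum_lower f).trans (P.splitSum_upper f).symm
  counit_left x e g he h := by
    obtain ⟨P, rfl⟩ := exists_toClass x
    rw [coprod_toClass, splitSum_eq_of_left _ _ fun s t hs => by rw [h s hs, zero_mul], he, one_mul]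
  counit_right x e g he h := by
    obtain ⟨P, rfl⟩ := exists_toClass x
    rw [coprod_toClass, splitSum_eq_of_right _ _ fun s t hs => by rw [h t hs, mul_zero], he,
      mul_one]
  coprod_one f := by
    have hs : Subsingleton empty.Splitting := ⟨fun c d => Splitting.ext_mem (fun x => x.elim)
      fun x => x.elim⟩
    have h1 : ∀ c : empty.Splitting, lower empty c = 1 ∧ upper empty c = 1 := fun c =>
      ⟨toClass_eq_one _ ⟨fun x => x.1.elim⟩, toClass_eq_one _ ⟨fun x => x.1.elim⟩⟩
    let c : empty.Splitting := .ofNotLt ∅ ∅ (fun x => x.elim) (fun x => x.elim)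
    have hc : (c.S ∩ c.T).ncard = 0 := (Set.ncard_eq_zero).2 (Set.empty_inter _)
    rw [← toClass_empty, coprod_toClass, splitSum_apply, Fintype.sum_subsingleton _ c, (h1 c).1,
      (h1 c).2, hc, pow_zero, one_mul]
    rfl
  coprod_mul x y f := by
    obtain ⟨P, rfl⟩ := exists_toClass x
    obtain ⟨Q, rfl⟩ := exists_toClass y
    exact P.splitSum_disjUnion Q f

end MarkedLabeledPoset

/-! ### Forgetting the valleys -/

/-- Transport of a coproduct along a surjective homomorphism compatible with the sizes. -/
def MonoidCoproduct.ofSurjective {R : Type u} {X : Type v} {Y : Type w} [CommRing R] [CommMonoid X]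
    [CommMonoid Y] (D : MonoidCoproduct R X) (q : X →* Y) (hq : Function.Surjective q)
    (coprod : Y → (Y → Y → R) →ₗ[R] R) (size : Y → ℕ)
    (hcoprod : ∀ x f, coprod (q x) f = D.coprod x fun s t => f (q s) (q t))
    (hsize : ∀ x, size (q x) = D.size x) : MonoidCoproduct R Y where
  coprod := coprod
  size := size
  size_mul := hq.forall₂.2 fun x y => by rw [← map_mul, hsize, hsize, hsize, D.size_mul]
  eq_one_of_size := hq.forall.2 fun x hx => by
    rw [D.eq_one_of_size x (by rwa [← hsize]), map_one]
  finite_size_le n := ((D.finite_size_le n).image q).subset <| hq.forall.2 fun x hx =>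
    ⟨x, (hsize x).symm.trans_le hx, rfl⟩
  coprod_eq_zero := hq.forall.2 fun x f h => by
    rw [hcoprod]
    exact D.coprod_eq_zero x _ fun s t hst => h _ _ (by rwa [hsize, hsize, hsize])
  coassoc := hq.forall.2 fun x f => by
    simp only [hcoprod]
    exact D.coassoc x fun s t u => f (q s) (q t) (q u)
  counit_left := hq.forall.2 fun x e g he h => by
    rw [hcoprod]
    refine D.counit_left x (fun s => e (q s)) (fun t => g (q t)) (by rw [map_one, he])
      fun s hs => h _ fun h1 => hs (D.eq_one_of_size s ?_)
    rw [← hsize, h1, ← map_one q, hsize, D.size_one]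
  counit_right := hq.forall.2 fun x e g he h => by
    rw [hcoprod]
    refine D.counit_right x (fun s => e (q s)) (fun t => g (q t)) (by rw [map_one, he])
      fun s hs => h _ fun h1 => hs (D.eq_one_of_size s ?_)
    rw [← hsize, h1, ← map_one q, hsize, D.size_one]
  coprod_one f := by rw [← map_one q, hcoprod, D.coprod_one]
  coprod_mul := hq.forall₂.2 fun x y f => by
    rw [← map_mul, hcoprod, D.coprod_mul]
    simp only [hcoprod, map_mul]

namespace LabeledPoset

open MarkedLabeledPoset

/-- The class of a labeled poset. -/
def toClass (P : LabeledPoset) : LPosetClass := Quotient.mk _ P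

/-- A labeled poset with no chosen valleys. -/
def unmarked (P : LabeledPoset) : MarkedLabeledPoset := ⟨P, ∅, Set.empty_subset _⟩

/-- Forgetting the chosen valleys. -/
def forget : LPosetPlusClass →* LPosetClass where
  toFun := Quotient.map MarkedLabeledPoset.toLabeledPoset fun _ _ ⟨φ, h, _⟩ => ⟨φ, h⟩
  map_one' := rfl
  map_mul' := by
    rintro ⟨P⟩ ⟨Q⟩
    rfl

theorem exists_toClass (x : LPosetClass) : ∃ P : LabeledPoset, P.toClass = x :=
  Quotient.exists_rep x

theorem forget_surjective : Function.Surjective forget := fun x => by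
  obtain ⟨P, rfl⟩ := exists_toClass x
  exact ⟨P.unmarked.toClass, rfl⟩

/-- The class of a labeled poset with no chosen valleys. -/
def unmarkedClass (x : LPosetClass) : LPosetPlusClass :=
  Quotient.map (sa := LabeledPoset.isoSetoid) (sb := MarkedLabeledPoset.isoSetoid) unmarked
    (fun _ _ ⟨φ, h⟩ => ⟨φ, h, Set.image_empty φ⟩) x

/-- The coproduct on isomorphism classes of labeled posets. -/
noncomputable def monoidCoproduct : MonoidCoproduct ZBeta LPosetClass :=
  MarkedLabeledPoset.monoidCoproduct.ofSurjective forget forget_surjective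
    (fun x =>
      { toFun := fun f => coprod (unmarkedClass x) fun s t => f (forget s) (forget t)
        map_add' := fun f g => map_add (coprod (unmarkedClass x))
          (fun s t => f (forget s) (forget t)) fun s t => g (forget s) (forget t)
        map_smul' := fun r f => map_smul (coprod (unmarkedClass x)) r
          fun s t => f (forget s) (forget t) })
    (fun x => size (unmarkedClass x))
    -- Chosen valleys enter the splitting sum only through the classes of the parts, where `forget`
    -- erases them; replacing `P` by its unmarked version changes nothing.
    (fun x f => by
      obtain ⟨P, rfl⟩ := MarkedLabeledPoset.exists_toClass x
      rfl)
    (fun x => by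
      obtain ⟨P, rfl⟩ := MarkedLabeledPoset.exists_toClass x
      rfl)

theorem toClass_eq_one_iff (P : LabeledPoset) : P.toClass = 1 ↔ IsEmpty P.carrier := by
  refine ⟨fun h => ?_, fun h => congrArg forget (P.unmarked.toClass_eq_one h)⟩
  obtain ⟨φ, -⟩ := Quotient.exact (h : Quotient.mk _ P = Quotient.mk _ empty)
  exact ⟨fun a => (φ a).elim⟩

end LabeledPoset

/-! ### Formulas on classes, uniqueness and conclusion -/

open LCForm MonoidCoproduct

open Classical in
theorem MLPoset.isStructure_lcMaps :
    MLPoset.IsStructure (LabeledPoset.monoidCoproduct.lcMaps : LCMaps MLPoset.lc) where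
  mul_cls P Q := lcMaps_mul_single LabeledPoset.monoidCoproduct P.toClass Q.toClass
  unit_one := lcMaps_unit_one LabeledPoset.monoidCoproduct
  comul_cls P := by
    refine TensorProduct.ext' fun a b => ?_
    refine (lcMaps_comul_single_tmul LabeledPoset.monoidCoproduct P.toClass a b).trans ?_
    rw [LinearMap.sum_apply]
    refine Finset.sum_congr rfl fun c _ => ?_
    refine congrArg _ (congr_arg₂ (· * ·) (completion_form_single a _).symm
      (completion_form_single b _).symm)
  counit_cls P := by
    refine (lcMaps_counit_single LabeledPoset.monoidCoproduct P.toClass).trans ?_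
    simp only [LabeledPoset.toClass_eq_one_iff]

open Classical in
theorem MLPosetPlus.isStructure_lcMaps :
    MLPosetPlus.IsStructure
      (MarkedLabeledPoset.monoidCoproduct.lcMaps : LCMaps MLPosetPlus.lc) where
  mul_cls P Q := lcMaps_mul_single MarkedLabeledPoset.monoidCoproduct P.toClass Q.toClass
  unit_one := lcMaps_unit_one MarkedLabeledPoset.monoidCoproduct
  comul_cls P := by
    refine TensorProduct.ext' fun a b => ?_
    refine (lcMaps_comul_single_tmul MarkedLabeledPoset.monoidCoproduct P.toClass a b).trans ?_
    rw [LinearMap.sum_apply]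
    refine Finset.sum_congr rfl fun c _ => ?_
    refine congrArg _ (congr_arg₂ (· * ·) (completion_form_single a _).symm
      (completion_form_single b _).symm)
  counit_cls P := by
    refine (lcMaps_counit_single MarkedLabeledPoset.monoidCoproduct P.toClass).trans ?_
    simp only [MarkedLabeledPoset.toClass_eq_one_iff]

theorem MLPoset.isPseudobasis_ofClass : IsPseudobasis MLPoset.lc MLPoset.ofClass := by
  classical
  exact isPseudobasis_completion

theorem MLPosetPlus.isPseudobasis_ofClass :
    IsPseudobasis MLPosetPlus.lc MLPosetPlus.ofClass := by
  classical
  exact isPseudobasis_completion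

/-- The formulas fix `∇` on pure tensors of classes, `Δ` and `ε` on classes and `ι` at `1`;
continuity extends the agreement everywhere. The Hopf property of any such maps then follows from
that of `lcMaps`. -/
theorem MLPoset.IsStructure.unique {M N : LCMaps MLPoset.lc} (hM : MLPoset.IsStructure M)
    (hN : MLPoset.IsStructure N) : M = N := by
  refine LCMaps.ext_of_isPseudobasis MLPoset.isPseudobasis_ofClass ?_
    (hM.unit_one.trans hN.unit_one.symm) ?_ ?_
  · rintro ⟨P⟩ ⟨Q⟩
    exact (hM.mul_cls P Q).trans (hN.mul_cls P Q).symm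
  · rintro ⟨P⟩
    exact (hM.comul_cls P).trans (hN.comul_cls P).symm
  · rintro ⟨P⟩
    exact (hM.counit_cls P).trans (hN.counit_cls P).symm

theorem MLPosetPlus.IsStructure.unique {M N : LCMaps MLPosetPlus.lc}
    (hM : MLPosetPlus.IsStructure M) (hN : MLPosetPlus.IsStructure N) : M = N := by
  refine LCMaps.ext_of_isPseudobasis MLPosetPlus.isPseudobasis_ofClass ?_
    (hM.unit_one.trans hN.unit_one.symm) ?_ ?_
  · rintro ⟨P⟩ ⟨Q⟩
    exact (hM.mul_cls P Q).trans (hN.mul_cls P Q).symm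
  · rintro ⟨P⟩
    exact (hM.comul_cls P).trans (hN.comul_cls P).symm
  · rintro ⟨P⟩
    exact (hM.counit_cls P).trans (hN.counit_cls P).symm

theorem mainTheorem10 :
    (LCForm.IsPseudobasis MLPoset.lc MLPoset.ofClass ∧
      (∃! M : LCMaps MLPoset.lc, MLPoset.IsStructure M) ∧
      ∀ M : LCMaps MLPoset.lc, MLPoset.IsStructure M →
        M.IsLCHopfAlgebra ∧ M.IsCommutative) ∧
    (LCForm.IsPseudobasis MLPosetPlus.lc MLPosetPlus.ofClass ∧
      (∃! M : LCMaps MLPosetPlus.lc, MLPosetPlus.IsStructure M) ∧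
      ∀ M : LCMaps MLPosetPlus.lc, MLPosetPlus.IsStructure M →
        M.IsLCHopfAlgebra ∧ M.IsCommutative) := by
  refine ⟨⟨MLPoset.isPseudobasis_ofClass, ⟨_, MLPoset.isStructure_lcMaps,
    fun M hM => hM.unique MLPoset.isStructure_lcMaps⟩, fun M hM => ?_⟩,
    MLPosetPlus.isPseudobasis_ofClass, ⟨_, MLPosetPlus.isStructure_lcMaps,
    fun M hM => hM.unique MLPosetPlus.isStructure_lcMaps⟩, fun M hM => ?_⟩
  · rw [hM.unique MLPoset.isStructure_lcMaps]
    exact ⟨lcMaps_isLCHopfAlgebra _, lcMaps_isCommutative _⟩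
  · rw [hM.unique MLPosetPlus.isStructure_lcMaps]
    exact ⟨lcMaps_isLCHopfAlgebra _, lcMaps_isCommutative _⟩
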